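/- Let $\kappa$ be a finite field with $q$ elements, $\overline{\kappa}$ an algebraic closure, and $\kappa_r\subset\overline{\kappa}$ the extension of $\kappa$ of degree $r$ ($r\ge 1$). All characters take values in $\overline{\mathbb{Q}}$; every multiplicative character $\eta$ (including the trivial one $\varepsilon$) is extended by $\eta(0)=0$, and $\overline{\eta}=\eta^{-1}$. **Character sums.** Let $F$ be a finite field and $\psi$ a non-trivial additive character of $F$. For multiplicative characters of $F$ put $$g(\eta)=-\sum_{x\in F^\times}\psi(x)\eta(x),\qquad g^\circ(\eta)=\begin{cases}\#F\cdot g(\eta)&(\eta=\varepsilon)\\ g(\eta)&(\eta\ne\varepsilon)\end{cases},\qquad (\alpha)_\nu=\frac{g(\alpha\nu)}{g(\alpha)},\qquad (\alpha)^\circ_\nu=\frac{g^\circ(\alpha\nu)}{g^\circ(\alpha)},$$ $$j(\eta_1,\dots,\eta_s)=(-1)^{s-1}\sum_{\substack{x_i\in F^\times\\ x_1+\cdots+x_s=1}}\prod_{i=1}^s\eta_i(x_i),$$ and, for $z_1,\dots,z_n\in F$, $$F_D^{(n)}\Big({\alpha;\beta_1,\dots,\beta_n\atop\gamma};z_1,\dots,z_n\Big)_F=\frac{1}{(1-\#F)^n}\sum_{\nu_1,\dots,\nu_n\in\widehat{F^\times}}\frac{(\alpha)_{\nu_1\cdots\nu_n}\prod_i(\beta_i)_{\nu_i}}{(\gamma)^\circ_{\nu_1\cdots\nu_n}\prod_i(\varepsilon)^\circ_{\nu_i}}\prod_i\nu_i(z_i).$$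 **Varieties and $L$-functions.** Let $n\ge1$, let $d,a,b_1,\dots,b_n,c$ be positive integers with $d\mid q-1$, and let $\lambda_1,\dots,\lambda_n\in\kappa^\times$. Let $C_{D,\lambda}$ and $S_{D,\lambda}$ be the affine varieties over $\kappa$ given by $$C_{D,\lambda}:\ y^d=\Big(\prod_{i=1}^n(1-\lambda_ix)^{b_i}\Big)x^a(1-x)^c,\qquad S_{D,\lambda}:\ y^d=\Big(1-\sum_{i=1}^n\lambda_ix_i\Big)^a\Big(\prod_{i=1}^nx_i^{b_i}\Big)\Big(1-\sum_{i=1}^nx_i\Big)^c.$$ The group $\mu_d\subset\kappa^\times$ of $d$-th roots of unity acts on both by $y\mapsto\xi y$. For $V$ one of them, $\rho\in\mathrm{Hom}(\mu_d,\overline{\mathbb{Q}}^\times)$, and $\mathrm{Fr}$ the $q$-Frobenius of $V(\overline{\kappa})$, let $$N_r(V;\rho)=\frac1d\sum_{\xi\in\mu_d}\rho(\xi)\,\#\{P\in V(\overline{\kappa})\mid \mathrm{Fr}^r(P)=\xi P\},\qquad L(V,\rho;t)=\exp\Big(\sum_{r=1}^\infty\frac{N_r(V;\rho)}{r}t^r\Big)\in\overline{\mathbb{Q}}[[t]].$$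 Fix a generator $\varphi$ of $\widehat{\kappa^\times}$ and put $\varphi_d=\varphi^{(q-1)/d}$, $\chi=\varphi|_{\mu_d}$ and $\varphi_{d,r}=\varphi_d\circ N_{\kappa_r/\kappa}$. Let $m\in\mathbb{Z}$, let a non-trivial additive character of each $\kappa_r$ be fixed, and put $$f_r(\lambda)=F_D^{(n)}\Big({\varphi_{d,r}^{ma};\overline{\varphi_{d,r}}^{\,mb_1},\dots,\overline{\varphi_{d,r}}^{\,mb_n}\atop\varphi_{d,r}^{m(c+a)}};\lambda_1,\dots,\lambda_n\Big)_{\kappa_r},\qquad g_r(\lambda)=F_D^{(n)}\Big({\overline{\varphi_{d,r}}^{\,ma};\varphi_{d,r}^{mb_1},\dots,\varphi_{d,r}^{mb_n}\atop\varphi_{d,r}^{m(b_1+\cdots+b_n+c)}};\lambda_1,\dots,\lambda_n\Big)_{\kappa_r}.$$ **Theorem.** (i) If $\gcd(d,c)=\gcd(d,b_i)=1$ for all $i$, then $$L(C_{D,\lambda},\chi^m;t)=\begin{cases}\dfrac1{1-qt}&(m\equiv0\bmod d),\\[2mm]\exp\Big(\displaystyle\sum_{r=1}^\infty j(\varphi_d^{ma},\varphi_d^{mc})^r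 f_r(\lambda)\frac{t^r}{r}\Big)^{-1}&(m\not\equiv0\bmod d).\end{cases}$$ (ii) If $\gcd(d,a)=\gcd(d,c)=1$, then $$L(S_{D,\lambda},\chi^m;t)=\begin{cases}\dfrac1{1-q^nt}&(m\equiv0\bmod d),\\[2mm]\exp\Big(\displaystyle\sum_{r=1}^\infty J_D^r\, g_r(\lambda)\frac{t^r}{r}\Big)^{(-1)^n}&(m\not\equiv0\bmod d),\end{cases}$$ where $J_D=j(\varphi_d^{mb_1},\dots,\varphi_d^{mb_n},\varphi_d^{mc})$. -/

import Mathlib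

open scoped BigOperators

noncomputable section

/-- The field of algebraic numbers, in which all characters take their values. -/
abbrev Qbar : Type := AlgebraicClosure ℚ

/-! ### Gauss sums, Jacobi sums and Lauricella's function over a finite field

Multiplicative characters are elements of `MulChar F Qbar`; they vanish at `0`, also the trivial one. -/

section CharacterSums

variable {F : Type*} [Field F] [Fintype F]

/-- The group of multiplicative characters of a finite field is finite. -/
instance mulCharFintype : Fintype (MulChar F Qbar) := Fintype.ofFinite _

/-- `g(η) = - ∑_{x ≠ 0} ψ(x) η(x)`. -/
def gaussG (ψ : AddChar F Qbar) (η : MulChar F Qbar) : Qbar :=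
  - gaussSum η ψ

open Classical in
/-- `g°(η) = q^{δ(η)} g(η)`, where `δ(η)` is `1` for trivial `η` and `0` otherwise. -/
def gaussGCirc (ψ : AddChar F Qbar) (η : MulChar F Qbar) : Qbar :=
  (if η = 1 then (Fintype.card F : Qbar) else 1) * gaussG ψ η

/-- `(α)_ν = g(αν) / g(α)`. -/
def poch (ψ : AddChar F Qbar) (α ν : MulChar F Qbar) : Qbar :=
  gaussG ψ (α * ν) / gaussG ψ α

/-- `(α)°_ν = g°(αν) / g°(α)`. -/
def pochCirc (ψ : AddChar F Qbar) (α ν : MulChar F Qbar) : Qbar :=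
  gaussGCirc ψ (α * ν) / gaussGCirc ψ α

open Classical in
/-- The Jacobi sum of the `n + 1` characters `η 0, …, η n`:
`(-1)^n ∑ ∏ η_i(x_i)` over nonzero `x_0, …, x_n` with `x_0 + ⋯ + x_n = 1`. -/
def jacobiJ {n : ℕ} (η : Fin (n + 1) → MulChar F Qbar) : Qbar :=
  (-1) ^ n * ∑ x : Fin (n + 1) → Fˣ with ∑ i, (x i : F) = 1, ∏ i, η i (x i : F)

/-- Lauricella's function `F_D^{(n)}(α; β_1, …, β_n; γ; z_1, …, z_n)` over `F`. -/
def lauricellaFD (ψ : AddChar F Qbar) {n : ℕ} (α : MulChar F Qbar)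
    (β : Fin n → MulChar F Qbar) (γ : MulChar F Qbar) (z : Fin n → F) : Qbar :=
  1 / (1 - (Fintype.card F : Qbar)) ^ n *
    ∑ ν : Fin n → MulChar F Qbar,
      poch ψ α (∏ i, ν i) * (∏ i, poch ψ (β i) (ν i)) /
        (pochCirc ψ γ (∏ i, ν i) * ∏ i, pochCirc ψ 1 (ν i)) * ∏ i, ν i (z i)

/-- The character `η ∘ N_{L/F}` of a finite extension `L` of `F`. -/
def normLift (L : Type*) [Field L] [Algebra F L] (η : MulChar F Qbar) : MulChar L Qbar :=
  MulChar.ofUnitHom (η.toUnitHom.comp (Units.map (Algebra.norm F : L →* F)))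

end CharacterSums

/-! ### Artin L-functions -/

/-- The power series `exp (∑_{r ≥ 1} u_r t^r / r)`. -/
def expSeries (u : ℕ+ → Qbar) : PowerSeries Qbar :=
  (PowerSeries.exp Qbar).subst
    (PowerSeries.mk fun r : ℕ => if h : 0 < r then u ⟨r, h⟩ / (r : Qbar) else 0)

/-- The power `E^{(-1)^n}` of an invertible power series `E`. -/
def signPow (E : PowerSeries Qbar) (n : ℕ) : PowerSeries Qbar :=
  if Even n then E else E⁻¹

/-- `N_r(V; χ) = (1/#G) ∑_{g ∈ G} χ(g) #{x ∈ V | F^r(x) = g x}`, where `V` is the set of geometric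
points, with its Frobenius `frob` and the action of the finite group `G`. -/
def twistedCount {V : Type*} (frob : V → V) {G : Type*} [CommGroup G] [Finite G] [MulAction G V]
    (χ : G →* Qbarˣ) (r : ℕ+) : Qbar :=
  1 / (Nat.card G : Qbar) *
    ∑ᶠ g : G, (χ g : Qbar) * (Nat.card {x : V // frob^[(r : ℕ)] x = g • x} : Qbar)

/-- The Artin L-function `L(V, χ; t) = exp (∑_{r ≥ 1} N_r(V; χ) t^r / r)`. -/
def artinL {V : Type*} (frob : V → V) {G : Type*} [CommGroup G] [Finite G] [MulAction G V]
    (χ : G →* Qbarˣ) : PowerSeries Qbar :=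
  expSeries (twistedCount frob χ)

/-! ### Affine hypersurfaces `y^d = f(x)` -/

section Cover

variable {k : Type*} [Field k]

/-- The geometric points `(x, y)` of the affine hypersurface `y^d = f(x)`. -/
def CoverPoints (kbar : Type*) [Field kbar] [Algebra k kbar] {σ : Type*} (d : ℕ)
    (f : MvPolynomial σ k) : Type _ :=
  {P : (σ → kbar) × kbar // P.2 ^ d = MvPolynomial.aeval P.1 f}

variable {kbar : Type*} [Field kbar] [Algebra k kbar] {σ : Type*} {d : ℕ} {f : MvPolynomial σ k}

/-- The `q`-Frobenius, raising all coordinates to the power `q = #k`. -/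
def CoverPoints.frob [Fintype k] (P : CoverPoints kbar d f) : CoverPoints kbar d f :=
  ⟨(fun i => P.1.1 i ^ Fintype.card k, P.1.2 ^ Fintype.card k), by
    have h := congrArg (FiniteField.frobeniusAlgHom k kbar) P.2
    rw [map_pow] at h
    exact h.trans (MvPolynomial.comp_aeval_apply P.1.1 (FiniteField.frobeniusAlgHom k kbar) f)⟩

/-- The action `ξ • (x, y) = (x, ξ y)` of the `d`-th roots of unity of `k`. -/
instance CoverPoints.rootsAction : MulAction (rootsOfUnity d k) (CoverPoints kbar d f) where
  smul ξ P := ⟨(P.1.1, algebraMap k kbar ((ξ : kˣ) : k) * P.1.2), by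
    have h : (((ξ : kˣ) : k)) ^ d = 1 := by
      have := (mem_rootsOfUnity d (ξ : kˣ)).1 ξ.2
      simpa using congrArg Units.val this
    simp only [mul_pow, ← map_pow, h, map_one, one_mul]
    exact P.2⟩
  one_smul P := Subtype.ext (Prod.ext rfl (by
    change algebraMap k kbar (((1 : rootsOfUnity d k) : kˣ) : k) * P.1.2 = P.1.2
    simp))
  mul_smul ξ η P := Subtype.ext (Prod.ext rfl (by
    change algebraMap k kbar (((ξ * η : rootsOfUnity d k) : kˣ) : k) * P.1.2
      = algebraMap k kbar ((ξ : kˣ) : k) * (algebraMap k kbar ((η : kˣ) : k) * P.1.2)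
    simp [mul_assoc]))

end Cover

section Varieties

variable {k : Type*} [Field k]

/-- `(∏ (1 - l_i x)^{b_i}) x^a (1 - x)^c`, the right-hand side of the equation of `C_{D,l}`. -/
def polyCD {n : ℕ} (a c : ℕ) (b : Fin n → ℕ) (l : Fin n → k) : MvPolynomial (Fin 1) k :=
  (∏ i, (1 - MvPolynomial.C (l i) * MvPolynomial.X 0) ^ b i) * MvPolynomial.X 0 ^ a *
    (1 - MvPolynomial.X 0) ^ c

/-- `(1 - ∑ l_i x_i)^a (∏ x_i^{b_i}) (1 - ∑ x_i)^c`, the right-hand side of the equation of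
`S_{D,l}`. -/
def polySD {n : ℕ} (a c : ℕ) (b : Fin n → ℕ) (l : Fin n → k) : MvPolynomial (Fin n) k :=
  (1 - ∑ i, MvPolynomial.C (l i) * MvPolynomial.X i) ^ a * (∏ i, MvPolynomial.X i ^ b i) *
    (1 - ∑ i, MvPolynomial.X i) ^ c

variable [Fintype k] (kbar : Type*) [Field kbar] [Algebra k kbar]

/-- `L(C_{D,l}, χ; t)` for a character `χ` of the group of `d`-th roots of unity of `k`. -/
def artinLCD {n : ℕ} (d : ℕ) [NeZero d] (a c : ℕ) (b : Fin n → ℕ) (l : Fin n → k)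
    (χ : rootsOfUnity d k →* Qbarˣ) : PowerSeries Qbar :=
  artinL (CoverPoints.frob : CoverPoints kbar d (polyCD a c b l) → _) χ

/-- `L(S_{D,l}, χ; t)` for a character `χ` of the group of `d`-th roots of unity of `k`. -/
def artinLSD {n : ℕ} (d : ℕ) [NeZero d] (a c : ℕ) (b : Fin n → ℕ) (l : Fin n → k)
    (χ : rootsOfUnity d k →* Qbarˣ) : PowerSeries Qbar :=
  artinL (CoverPoints.frob : CoverPoints kbar d (polySD a c b l) → _) χ

/-- `φ_d = φ^{(q-1)/d}`. -/
def charD (φ : MulChar k Qbar) (d : ℕ) : MulChar k Qbar :=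
  φ ^ ((Fintype.card k - 1) / d)

/-- The restriction of `φ` to the group of `d`-th roots of unity of `k`. -/
def restrictRoots (φ : MulChar k Qbar) (d : ℕ) : rootsOfUnity d k →* Qbarˣ :=
  φ.toUnitHom.comp (rootsOfUnity d k).subtype

end Varieties

end

/-! Both sides are exponentials, so the claim is an identity between the `r`-th terms for each `r`.
Write `K` for the extension of degree `r`. Above a nonzero `u` in `K` the equation `y^d = u` has `d`
solutions, and the `r`-th power of Frobenius multiplies all of them by the same root of unity
`N(u)^((q-1)/d)`; averaging against `χ^m` gives the value at `u` of the lift of `φ_d^m` along the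
norm. Above `u = 0` the only point is fixed by all of `μ_d`, and a nontrivial `χ^m` averages to `0`.
So the twisted count is a character sum over affine space (`twistedCount_zpow`), and the number of
points of affine space when `χ^m` is trivial (`twistedCount_one`).

These sums are finite-field analogues of Euler integrals. The binomial theorem
(`sum_poch_mul_prod`), which is Fourier inversion with Jacobi sums as coefficients, expands each
factor `1 - λ_i x` for `C`, and the single factor `1 - ∑ λ_i x_i` for `S`. Summing over `x` leaves
Jacobi sums of shifted characters; written in Gauss sums they are one fixed Jacobi sum times the
coefficients of `F_D` (`jacobiJ_pair_mul_lauricellaFD`, `jacobiJ_mul_lauricellaFD`). The modified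
`g°` makes these formulas uniform at trivial characters.

It remains to see that the Jacobi sum over `K` is the `r`-th power of the one over `k`. This follows
from the Hasse–Davenport relation (`gaussG_normLift`), proved by comparing the series `∑ λ(f) T^(deg
f)` over monic `f`, which is `1 + (Gauss sum) T`, with its Euler product. Jacobi sums do not involve
`ψ`, so the additive characters of the different extensions need not be compatible. -/

noncomputable section

/-! ### The series `exp (∑ u_r t^r / r)` -/

section ExpSeries

open PowerSeries

/-- The exponent `∑_{r ≥ 1} u_r t^r / r` of `expSeries u`. -/
def expExponent (u : ℕ+ → Qbar) : PowerSeries Qbar :=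
  PowerSeries.mk fun r : ℕ => if h : 0 < r then u ⟨r, h⟩ / (r : Qbar) else 0

lemma constantCoeff_expExponent (u : ℕ+ → Qbar) : constantCoeff (expExponent u) = 0 := by
  simp [expExponent]

lemma hasSubst_expExponent (u : ℕ+ → Qbar) : HasSubst (expExponent u) :=
  HasSubst.of_constantCoeff_zero' (constantCoeff_expExponent u)

/-- In characteristic zero a power series is determined by its derivative and constant term, so
identities between such exponentials can be checked on logarithmic derivatives, where the
denominators `r` disappear. -/
lemma derivative_expSeries (u : ℕ+ → Qbar) :
    d⁄dX Qbar (expSeries u) =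
      expSeries u * PowerSeries.mk fun r : ℕ => u ⟨r + 1, r.succ_pos⟩ := by
  have h := derivative_subst (f := PowerSeries.exp Qbar) (hasSubst_expExponent u)
  rw [derivative_exp] at h
  refine h.trans (congrArg (expSeries u * ·) ?_)
  ext r
  have : (r : Qbar) + 1 ≠ 0 := by exact_mod_cast r.succ_ne_zero
  simp only [coeff_derivative, expExponent, coeff_mk, Nat.succ_pos, dif_pos]
  push_cast
  field_simp

lemma constantCoeff_expSeries (u : ℕ+ → Qbar) : constantCoeff (expSeries u) = 1 := by
  change constantCoeff ((PowerSeries.exp Qbar).subst (expExponent u)) = 1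
  refine (constantCoeff_subst (hasSubst_expExponent u) _).trans ?_
  rw [finsum_eq_single _ 0]
  · simp
  · intro k hk
    change _ • constantCoeff (expExponent u ^ k) = _
    rw [map_pow, constantCoeff_expExponent, zero_pow hk, smul_zero]

lemma expSeries_neg (u : ℕ+ → Qbar) : expSeries (fun r => -u r) = (expSeries u)⁻¹ := by
  rw [PowerSeries.eq_inv_iff_mul_eq_one (by simp [constantCoeff_expSeries])]
  apply derivative.ext
  · have : (PowerSeries.mk fun r : ℕ => -u ⟨r + 1, r.succ_pos⟩) =
        -(PowerSeries.mk fun r : ℕ => u ⟨r + 1, r.succ_pos⟩) := by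
      ext; simp
    rw [Derivation.leibniz, derivative_expSeries, derivative_expSeries, this, derivative_one]
    simp only [smul_eq_mul]
    ring
  · simp [constantCoeff_expSeries]

lemma expSeries_pow (q : Qbar) :
    expSeries (fun r => q ^ (r : ℕ)) = (1 - C q * X)⁻¹ := by
  rw [PowerSeries.eq_inv_iff_mul_eq_one (by simp)]
  apply derivative.ext
  · have h : (PowerSeries.mk fun r : ℕ => q ^ (r + 1)) * (1 - C q * X) = C q := by
      ext r
      rw [mul_sub, mul_one, map_sub, mul_left_comm, coeff_C_mul]
      cases r with
      | zero => simp
      | succ r => simp [pow_succ, mul_comm]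
    rw [Derivation.leibniz, derivative_expSeries, derivative_one]
    simp only [smul_eq_mul, PNat.mk_coe, map_sub, derivative_one, Derivation.leibniz,
      derivative_X, derivative_C, mul_one, mul_zero, add_zero, zero_sub]
    rw [mul_left_comm, mul_comm (1 - _), h]
    ring
  · simp [constantCoeff_expSeries]

end ExpSeries

/-! ### Jacobi sums in terms of Gauss sums -/

section CharacterValues

variable {F : Type*} [Field F]

/-- At `x = 0` the empty product would give `0` on the left and `1` on the right. -/
lemma mulChar_prod_apply {ι : Type*} (s : Finset ι) (η : ι → MulChar F Qbar) (x : F) (hx : x ≠ 0) :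
    (∏ i ∈ s, η i) x = ∏ i ∈ s, η i x := by
  classical
  induction s using Finset.induction_on with
  | empty => simp [MulChar.one_apply hx.isUnit]
  | insert i s hi ih => rw [Finset.prod_insert hi, Finset.prod_insert hi, MulChar.mul_apply, ih]

lemma addChar_map_sum {ι : Type*} (s : Finset ι) (ψ : AddChar F Qbar) (x : ι → F) :
    ψ (∑ i ∈ s, x i) = ∏ i ∈ s, ψ (x i) := by
  classical
  induction s using Finset.induction_on with
  | empty => simp
  | insert i s hi ih =>
    rw [Finset.sum_insert hi, Finset.prod_insert hi, AddChar.map_add_eq_mul, ih]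

lemma map_neg_one_ne_zero (η : MulChar F Qbar) : η (-1) ≠ 0 :=
  ((isUnit_one.neg : IsUnit (-1 : F)).map η).ne_zero

end CharacterValues

section JacobiGauss

variable {F : Type*} [Field F] [Fintype F]

open Classical in
/-- The sum of `∏ η_i(x_i)` over the tuples `x` with `∑ x_i = t`. -/
def jacobiLevel {n : ℕ} (η : Fin (n + 1) → MulChar F Qbar) (t : F) : Qbar :=
  ∑ x : Fin (n + 1) → F with ∑ i, x i = t, ∏ i, η i (x i)

lemma jacobiJ_eq_jacobiLevel {n : ℕ} (η : Fin (n + 1) → MulChar F Qbar) :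
    jacobiJ η = (-1) ^ n * jacobiLevel η 1 := by
  classical
  unfold jacobiJ jacobiLevel
  congr 1
  refine Finset.sum_of_injOn (fun x i => (x i : F)) ?_ ?_ ?_ ?_
  · intro x _ y _ h
    funext i
    exact Units.ext (congrFun h i)
  · intro x hx
    simpa using hx
  · intro x hx hx'
    by_contra h
    have h0 : ∀ i, x i ≠ 0 := fun i hi =>
      h (Finset.prod_eq_zero (Finset.mem_univ i) (by rw [hi, MulChar.map_zero]))
    exact hx' ⟨fun i => Units.mk0 (x i) (h0 i), by simpa using hx, by funext i; simp⟩
  · intro x _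
    rfl

lemma jacobiJ_snoc {n : ℕ} (η : Fin n → MulChar F Qbar) (θ : MulChar F Qbar) :
    jacobiJ (Fin.snoc (α := fun _ => MulChar F Qbar) η θ) =
      (-1) ^ n * ∑ x : Fin n → F, (∏ i, η i (x i)) * θ (1 - ∑ i, x i) := by
  classical
  rw [jacobiJ_eq_jacobiLevel, jacobiLevel, Finset.sum_filter,
    ← (Fin.snocEquiv (fun _ : Fin (n + 1) => F)).sum_comp, Fintype.sum_prod_type,
    Finset.sum_comm]
  congr 1
  refine Finset.sum_congr rfl fun x _ => ?_
  rw [Finset.sum_eq_single (1 - ∑ i, x i)]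
  · simp [Fin.snocEquiv, Fin.prod_univ_castSucc, Fin.sum_univ_castSucc]
  · intro t _ ht
    rw [if_neg]
    simp only [Fin.snocEquiv, Equiv.coe_fn_mk, Fin.sum_univ_castSucc, Fin.snoc_castSucc,
      Fin.snoc_last]
    intro h
    exact ht (by rw [← h]; ring)
  · simp

/-- Scaling by `t` identifies the hyperplane of level `1` with that of level `t`. -/
lemma jacobiLevel_of_ne_zero {n : ℕ} (η : Fin (n + 1) → MulChar F Qbar) {t : F} (ht : t ≠ 0) :
    jacobiLevel η t = (∏ i, η i) t * jacobiLevel η 1 := by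
  classical
  unfold jacobiLevel
  rw [Finset.mul_sum]
  refine (Finset.sum_bij' (fun x _ i => t * x i) (fun x _ i => t⁻¹ * x i) ?_ ?_ ?_ ?_ ?_).symm
  · intro x hx
    simp only [Finset.mem_filter, Finset.mem_univ, true_and, ← Finset.mul_sum] at hx ⊢
    rw [hx, mul_one]
  · intro x hx
    simp only [Finset.mem_filter, Finset.mem_univ, true_and, ← Finset.mul_sum] at hx ⊢
    rw [hx, inv_mul_cancel₀ ht]
  · intro x _; funext i; field_simp
  · intro x _; funext i; field_simp
  · intro x _
    simp only [map_mul, Finset.prod_mul_distrib, mulChar_prod_apply _ _ _ ht]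

/-- Tuples are grouped by their sum, and all nonzero levels reduce to level `1`. The weights `w = ψ`
and `w = 1` give two linear relations between the levels `0` and `1`, from which Jacobi sums are
computed. -/
lemma sum_weight_mul_prod {n : ℕ} (η : Fin (n + 1) → MulChar F Qbar) (w : F → Qbar) :
    ∑ x : Fin (n + 1) → F, w (∑ i, x i) * ∏ i, η i (x i) =
      w 0 * jacobiLevel η 0 + jacobiLevel η 1 * ∑ t, (∏ i, η i) t * w t := by
  classical
  have h1 : ∑ x : Fin (n + 1) → F, w (∑ i, x i) * ∏ i, η i (x i) =
      ∑ t, w t * jacobiLevel η t := by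
    rw [← Finset.sum_fiberwise Finset.univ (fun x : Fin (n + 1) → F => ∑ i, x i)]
    refine Finset.sum_congr rfl fun t _ => ?_
    rw [jacobiLevel, Finset.mul_sum]
    refine Finset.sum_congr rfl fun x hx => ?_
    rw [(Finset.mem_filter.1 hx).2]
  rw [h1, Fintype.sum_eq_add_sum_compl (0 : F), Fintype.sum_eq_add_sum_compl (0 : F)
    (fun t => (∏ i, η i) t * w t), MulChar.map_zero, zero_mul, zero_add, Finset.mul_sum]
  congr 1
  refine Finset.sum_congr rfl fun t ht => ?_
  rw [jacobiLevel_of_ne_zero η (by simpa using ht)]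
  ring

lemma prod_gaussSum {n : ℕ} (η : Fin (n + 1) → MulChar F Qbar) (ψ : AddChar F Qbar) :
    ∏ i, gaussSum (η i) ψ =
      jacobiLevel η 0 + jacobiLevel η 1 * gaussSum (∏ i, η i) ψ := by
  classical
  have h := sum_weight_mul_prod η ψ
  rw [AddChar.map_zero_eq_one, one_mul] at h
  unfold gaussSum
  rw [← h, Finset.prod_univ_sum, Fintype.piFinset_univ]
  refine Finset.sum_congr rfl fun x _ => ?_
  rw [Finset.prod_mul_distrib, addChar_map_sum, mul_comm]

lemma jacobiLevel_add_eq_zero {n : ℕ} {η : Fin (n + 1) → MulChar F Qbar} {i : Fin (n + 1)}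
    (hi : η i ≠ 1) :
    jacobiLevel η 0 + jacobiLevel η 1 * ∑ t, (∏ i, η i) t = 0 := by
  classical
  have h := sum_weight_mul_prod η 1
  simp only [Pi.one_apply, one_mul, mul_one] at h
  rw [← h, ← Fintype.piFinset_univ, ← Finset.prod_univ_sum (fun _ => Finset.univ)
    (fun i x => η i x)]
  exact Finset.prod_eq_zero (Finset.mem_univ i) (MulChar.sum_eq_zero_of_ne_one hi)

lemma card_ne_zero_Qbar : (Fintype.card F : Qbar) ≠ 0 := by
  exact_mod_cast Fintype.card_ne_zero

lemma one_sub_card_ne_zero : (1 - Fintype.card F : Qbar) ≠ 0 := by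
  rw [sub_ne_zero]
  exact_mod_cast (Fintype.one_lt_card (α := F)).ne

lemma gaussG_one {ψ : AddChar F Qbar} (hψ : ψ ≠ 1) : gaussG ψ 1 = 1 := by
  rw [gaussG, gaussSum_one_left hψ, neg_neg]

lemma gaussGCirc_one {ψ : AddChar F Qbar} (hψ : ψ ≠ 1) :
    gaussGCirc ψ 1 = Fintype.card F := by
  rw [gaussGCirc, if_pos rfl, gaussG_one hψ, mul_one]

lemma gaussGCirc_of_ne_one (ψ : AddChar F Qbar) {η : MulChar F Qbar} (hη : η ≠ 1) :
    gaussGCirc ψ η = gaussG ψ η := by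
  rw [gaussGCirc, if_neg hη, one_mul]

/-- The reflection formula. The factor `q` in `g°` makes it hold for the trivial character too; in
particular no Gauss sum vanishes. -/
lemma gaussG_mul_gaussGCirc_inv {ψ : AddChar F Qbar} (hψ : ψ ≠ 1) (η : MulChar F Qbar) :
    gaussG ψ η * gaussGCirc ψ η⁻¹ = η (-1) * Fintype.card F := by
  by_cases h : η = 1
  · subst h
    rw [inv_one, gaussG_one hψ, gaussGCirc_one hψ, MulChar.one_apply (isUnit_one.neg)]
  · rw [gaussGCirc_of_ne_one ψ (inv_ne_one.2 h), gaussG, gaussG, neg_mul_neg,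
      ← mul_gaussSum_inv_eq_gaussSum η⁻¹, mul_left_comm,
      gaussSum_mul_gaussSum_eq_card h (AddChar.IsPrimitive.of_ne_one hψ), MulChar.inv_apply',
      inv_neg_one]

lemma gaussG_ne_zero {ψ : AddChar F Qbar} (hψ : ψ ≠ 1) (η : MulChar F Qbar) :
    gaussG ψ η ≠ 0 := by
  have := gaussG_mul_gaussGCirc_inv hψ η
  exact left_ne_zero_of_mul (this ▸ mul_ne_zero (map_neg_one_ne_zero η) card_ne_zero_Qbar)

lemma gaussGCirc_ne_zero {ψ : AddChar F Qbar} (hψ : ψ ≠ 1) (η : MulChar F Qbar) :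
    gaussGCirc ψ η ≠ 0 := by
  unfold gaussGCirc
  refine mul_ne_zero ?_ (gaussG_ne_zero hψ η)
  split_ifs
  · exact card_ne_zero_Qbar
  · exact one_ne_zero

/-- A Jacobi sum of characters that are not all trivial, in terms of Gauss sums. -/
lemma jacobiJ_mul_gaussGCirc {ψ : AddChar F Qbar} (hψ : ψ ≠ 1) {n : ℕ}
    {η : Fin (n + 1) → MulChar F Qbar} {i : Fin (n + 1)} (hi : η i ≠ 1) :
    jacobiJ η * gaussGCirc ψ (∏ i, η i) = ∏ i, gaussG ψ (η i) := by
  classical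
  have h1 := prod_gaussSum η ψ
  have h2 := jacobiLevel_add_eq_zero hi
  have h3 : ∏ i, gaussG ψ (η i) = (-1) ^ (n + 1) * ∏ i, gaussSum (η i) ψ := by
    simp [gaussG, Finset.prod_neg]
  rw [h3, h1, jacobiJ_eq_jacobiLevel]
  -- If the product is trivial, level `0` is `-(q - 1)` times level `1`, so the product of Gauss
  -- sums is `-q` times level `1`, and `g°` supplies this `q`. Otherwise level `0` vanishes.
  by_cases h : ∏ i, η i = 1
  · rw [h] at h2 ⊢
    rw [MulChar.sum_one_eq_card_units, Fintype.card_units,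
      Nat.cast_sub Fintype.card_pos] at h2
    rw [gaussGCirc_one hψ, gaussSum_one_left hψ, eq_neg_of_add_eq_zero_left h2]
    push_cast
    ring
  · rw [MulChar.sum_eq_zero_of_ne_one h, mul_zero, add_zero] at h2
    rw [gaussGCirc_of_ne_one ψ h, h2, gaussG]
    ring

lemma jacobiJ_snoc_eq {ψ : AddChar F Qbar} (hψ : ψ ≠ 1) {n : ℕ}
    (η : Fin n → MulChar F Qbar) {θ : MulChar F Qbar} (hθ : θ ≠ 1) :
    jacobiJ (Fin.snoc (α := fun _ => MulChar F Qbar) η θ) =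
      (∏ i, gaussG ψ (η i)) * gaussG ψ θ / gaussGCirc ψ ((∏ i, η i) * θ) := by
  have h := jacobiJ_mul_gaussGCirc hψ (η := Fin.snoc (α := fun _ => MulChar F Qbar) η θ)
    (i := Fin.last n) (by simpa using hθ)
  simp only [Fin.prod_univ_castSucc, Fin.snoc_castSucc, Fin.snoc_last] at h
  rw [eq_div_iff (gaussGCirc_ne_zero hψ _), h]

end JacobiGauss

/-! ### The binomial theorem and the integral representations -/

section Integral

variable {F : Type*} [Field F] [Fintype F]

lemma sum_mulChar_inv_mul {x z : F} (hz : z ≠ 0) [Decidable (x = z)] :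
    ∑ ν : MulChar F Qbar, ν⁻¹ x * ν z = if x = z then (Fintype.card F : Qbar) - 1 else 0 := by
  classical
  by_cases hx : x = 0
  · subst hx
    simp only [MulChar.map_zero, zero_mul, Finset.sum_const_zero, if_neg hz.symm]
  have h (ν : MulChar F Qbar) : ν⁻¹ x * ν z = ν (x⁻¹ * z) := by
    rw [MulChar.inv_apply', map_mul]
  simp only [h]
  split_ifs with hxz
  · subst hxz
    have hc := MulChar.card_eq_card_units_of_hasEnoughRootsOfUnity F Qbar
    rw [Nat.card_eq_fintype_card, Nat.card_eq_fintype_card, Fintype.card_units] at hc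
    simp [inv_mul_cancel₀ hx, hc, Nat.cast_sub (Fintype.card_pos (α := F))]
  · have hne : x⁻¹ * z ≠ 1 := by
      intro h
      exact hxz (by field_simp at h; exact h.symm)
    obtain ⟨χ, hχ⟩ := MulChar.exists_apply_ne_one_of_hasEnoughRootsOfUnity F Qbar hne
    refine eq_zero_of_mul_eq_self_left hχ ?_
    rw [Finset.mul_sum]
    exact Fintype.sum_bijective (χ * ·) (Group.mulLeft_bijective χ) _ _ fun ν => by
      rw [MulChar.mul_apply]

/-- By reflection each `1 / g°(ν_i)` becomes a multiple of `g(ν_i⁻¹)` and `g(α ∏ ν_i)` a multiple of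
`1 / g°` of the inverse; the values at `-1` and the powers of `q` cancel. The binomial coefficients
thus become Jacobi sums, which can be unfolded into sums over `Fⁿ`. -/
lemma poch_div_prod_pochCirc {ψ : AddChar F Qbar} (hψ : ψ ≠ 1) {n : ℕ} {α : MulChar F Qbar}
    (hα : α ≠ 1) (ν : Fin n → MulChar F Qbar) :
    poch ψ α (∏ i, ν i) / ∏ i, pochCirc ψ 1 (ν i) =
      jacobiJ (Fin.snoc (α := fun _ => MulChar F Qbar) (fun i => (ν i)⁻¹) α⁻¹) := by
  have hinv (η : MulChar F Qbar) : η⁻¹ (-1) = η (-1) := by rw [MulChar.inv_apply', inv_neg_one]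
  have hG (η : MulChar F Qbar) :
      gaussG ψ η⁻¹ = η (-1) * Fintype.card F / gaussGCirc ψ η := by
    rw [eq_div_iff (gaussGCirc_ne_zero hψ _), ← hinv, ← gaussG_mul_gaussGCirc_inv hψ, inv_inv]
  have hC : gaussGCirc ψ ((∏ i, (ν i)⁻¹) * α⁻¹) =
      (α * ∏ i, ν i) (-1) * Fintype.card F / gaussG ψ (α * ∏ i, ν i) := by
    rw [eq_div_iff (gaussG_ne_zero hψ _), ← gaussG_mul_gaussGCirc_inv hψ, mul_comm]
    simp [mul_comm]
  rw [jacobiJ_snoc_eq hψ _ (inv_ne_one.2 hα), hC]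
  simp only [hG, poch, pochCirc, one_mul, gaussGCirc_one hψ, gaussGCirc_of_ne_one ψ hα,
    Finset.prod_div_distrib, Finset.prod_mul_distrib, MulChar.mul_apply,
    mulChar_prod_apply _ _ _ (neg_ne_zero.2 (one_ne_zero (α := F)))]
  have h1 : ∏ i, gaussGCirc ψ (ν i) ≠ 0 :=
    Finset.prod_ne_zero_iff.2 fun i _ => gaussGCirc_ne_zero hψ _
  have h2 : ∏ i, ν i (-1) ≠ 0 :=
    Finset.prod_ne_zero_iff.2 fun i _ => map_neg_one_ne_zero _
  have h3 := map_neg_one_ne_zero α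
  have h4 := gaussG_ne_zero hψ α
  have h5 := gaussG_ne_zero hψ (α * ∏ i, ν i)
  have h6 := card_ne_zero_Qbar (F := F)
  have h7 : (∏ _i : Fin n, (Fintype.card F : Qbar)) ≠ 0 :=
    Finset.prod_ne_zero_iff.2 fun i _ => h6
  field_simp

/-- The binomial theorem in several variables over a finite field. -/
lemma sum_poch_mul_prod {ψ : AddChar F Qbar} (hψ : ψ ≠ 1) {n : ℕ} {α : MulChar F Qbar}
    (hα : α ≠ 1) (z : Fin n → F) (hz : ∀ i, z i ≠ 0) :
    ∑ ν : Fin n → MulChar F Qbar,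
        poch ψ α (∏ i, ν i) / (∏ i, pochCirc ψ 1 (ν i)) * ∏ i, ν i (z i) =
      (1 - Fintype.card F) ^ n * α⁻¹ (1 - ∑ i, z i) := by
  classical
  simp only [poch_div_prod_pochCirc hψ hα, jacobiJ_snoc, mul_assoc, Finset.sum_mul]
  rw [← Finset.mul_sum, Finset.sum_comm]
  -- Orthogonality in each coordinate leaves only the tuple `x = z`.
  have h (x : Fin n → F) : ∑ ν : Fin n → MulChar F Qbar,
      (∏ i, (ν i)⁻¹ (x i)) * (α⁻¹ (1 - ∑ i, x i) * ∏ i, ν i (z i)) =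
      if x = z then ((Fintype.card F : Qbar) - 1) ^ n * α⁻¹ (1 - ∑ i, z i) else 0 := by
    have h' (ν : Fin n → MulChar F Qbar) :
        (∏ i, (ν i)⁻¹ (x i)) * (α⁻¹ (1 - ∑ i, x i) * ∏ i, ν i (z i)) =
        (∏ i, ((ν i)⁻¹ (x i) * ν i (z i))) * α⁻¹ (1 - ∑ i, x i) := by
      rw [Finset.prod_mul_distrib]; ring
    simp only [h']
    rw [← Finset.sum_mul, ← Fintype.piFinset_univ, ← Finset.prod_univ_sum (fun _ => Finset.univ)
      (fun i (ν : MulChar F Qbar) => ν⁻¹ (x i) * ν (z i))]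
    simp only [sum_mulChar_inv_mul (hz _)]
    split_ifs with hxz
    · subst hxz
      simp
    · obtain ⟨i, hi⟩ := Function.ne_iff.1 hxz
      rw [Finset.prod_eq_zero (Finset.mem_univ i) (if_neg hi), zero_mul]
  simp only [h, Finset.sum_ite_eq', Finset.mem_univ, if_true]
  rw [← mul_assoc, ← mul_pow]
  ring

lemma sum_poch_mul {ψ : AddChar F Qbar} (hψ : ψ ≠ 1) {β : MulChar F Qbar}
    (hβ : β ≠ 1) (z : F) (hz : z ≠ 0) :
    ∑ ν : MulChar F Qbar, poch ψ β ν / pochCirc ψ 1 ν * ν z =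
      (1 - Fintype.card F) * β⁻¹ (1 - z) := by
  have h := sum_poch_mul_prod hψ hβ (fun _ : Fin 1 => z) (fun _ => hz)
  rw [← (Equiv.funUnique (Fin 1) (MulChar F Qbar)).symm.sum_comp] at h
  simpa using h

/-- Lauricella's function as a sum over `Fⁿ`. -/
theorem jacobiJ_mul_lauricellaFD {ψ : AddChar F Qbar} (hψ : ψ ≠ 1) {n : ℕ} {α θ : MulChar F Qbar}
    (hα : α ≠ 1) (hθ : θ ≠ 1) (β : Fin n → MulChar F Qbar) (z : Fin n → F) (hz : ∀ i, z i ≠ 0) :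
    jacobiJ (Fin.snoc (α := fun _ => MulChar F Qbar) β θ) *
        lauricellaFD ψ α β ((∏ i, β i) * θ) z =
      (-1) ^ n * ∑ x : Fin n → F,
        α⁻¹ (1 - ∑ i, z i * x i) * (∏ i, β i (x i)) * θ (1 - ∑ i, x i) := by
  classical
  -- Shifting the `β_i` by `ν_i` multiplies the Jacobi sum by exactly the part of the coefficient of
  -- `F_D` that the binomial theorem does not provide.
  have hJ (ν : Fin n → MulChar F Qbar) :
      jacobiJ (Fin.snoc (α := fun _ => MulChar F Qbar) (fun i => β i * ν i) θ) =
        jacobiJ (Fin.snoc (α := fun _ => MulChar F Qbar) β θ) * (∏ i, poch ψ (β i) (ν i)) /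
          pochCirc ψ ((∏ i, β i) * θ) (∏ i, ν i) := by
    rw [jacobiJ_snoc_eq hψ _ hθ, jacobiJ_snoc_eq hψ _ hθ, Finset.prod_mul_distrib,
      mul_right_comm (∏ i, β i)]
    simp only [poch, pochCirc, Finset.prod_div_distrib]
    have h1 : ∏ i, gaussG ψ (β i) ≠ 0 :=
      Finset.prod_ne_zero_iff.2 fun i _ => gaussG_ne_zero hψ _
    have h2 := gaussGCirc_ne_zero hψ ((∏ i, β i) * θ)
    have h3 := gaussGCirc_ne_zero hψ ((∏ i, β i) * θ * ∏ i, ν i)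
    field_simp
  have hx (x : Fin n → F) :
      α⁻¹ (1 - ∑ i, z i * x i) * (∏ i, β i (x i)) * θ (1 - ∑ i, x i) =
        1 / (1 - (Fintype.card F : Qbar)) ^ n * ∑ ν : Fin n → MulChar F Qbar,
          poch ψ α (∏ i, ν i) / (∏ i, pochCirc ψ 1 (ν i)) * (∏ i, ν i (z i)) *
            ((∏ i, (β i * ν i) (x i)) * θ (1 - ∑ i, x i)) := by
    -- The binomial theorem needs nonzero arguments. On the coordinate hyperplanes both sides
    -- vanish, since even a trivial `β i` is `0` at `0`.
    by_cases h0 : ∃ i, x i = 0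
    · obtain ⟨i, hi⟩ := h0
      have e1 : ∏ i, β i (x i) = 0 :=
        Finset.prod_eq_zero (Finset.mem_univ i) (by rw [hi, MulChar.map_zero])
      have e2 (ν : Fin n → MulChar F Qbar) : ∏ i, (β i * ν i) (x i) = 0 :=
        Finset.prod_eq_zero (Finset.mem_univ i) (by rw [hi, MulChar.map_zero])
      simp only [e1, e2, zero_mul, mul_zero, Finset.sum_const_zero]
    · push Not at h0
      have h := sum_poch_mul_prod hψ hα (fun i => z i * x i) (fun i => mul_ne_zero (hz i) (h0 i))
      have h' : (1 - (Fintype.card F : Qbar)) ^ n ≠ 0 := pow_ne_zero _ one_sub_card_ne_zero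
      rw [one_div, eq_inv_mul_iff_mul_eq₀ h', ← mul_assoc, ← mul_assoc, ← h, Finset.sum_mul,
        Finset.sum_mul]
      refine Finset.sum_congr rfl fun ν _ => ?_
      simp only [map_mul, MulChar.mul_apply, Finset.prod_mul_distrib]
      ring
  simp only [hx]
  rw [← Finset.mul_sum, Finset.sum_comm, lauricellaFD, mul_left_comm, mul_left_comm ((-1) ^ n)]
  congr 1
  rw [Finset.mul_sum, Finset.mul_sum]
  refine Finset.sum_congr rfl fun ν _ => ?_
  rw [← Finset.mul_sum, mul_left_comm ((-1) ^ n), ← jacobiJ_snoc, hJ]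
  have h1 : ∏ i, pochCirc ψ 1 (ν i) ≠ 0 := Finset.prod_ne_zero_iff.2 fun i _ =>
    div_ne_zero (gaussGCirc_ne_zero hψ _) (gaussGCirc_ne_zero hψ _)
  have h2 : pochCirc ψ ((∏ i, β i) * θ) (∏ i, ν i) ≠ 0 :=
    div_ne_zero (gaussGCirc_ne_zero hψ _) (gaussGCirc_ne_zero hψ _)
  field_simp

lemma jacobiJ_pair (α θ : MulChar F Qbar) :
    jacobiJ ![α, θ] = -∑ x, α x * θ (1 - x) := by
  have h := jacobiJ_snoc (fun _ : Fin 1 => α) θ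
  have e : (Fin.snoc (α := fun _ => MulChar F Qbar) (fun _ : Fin 1 => α) θ) = ![α, θ] := by
    funext i
    fin_cases i <;> rfl
  rw [e, ← (Equiv.funUnique (Fin 1) F).symm.sum_comp] at h
  simpa using h

lemma jacobiJ_pair_eq {ψ : AddChar F Qbar} (hψ : ψ ≠ 1) (α : MulChar F Qbar) {θ : MulChar F Qbar}
    (hθ : θ ≠ 1) :
    jacobiJ ![α, θ] = gaussG ψ α * gaussG ψ θ / gaussGCirc ψ (α * θ) := by
  have h := jacobiJ_mul_gaussGCirc hψ (η := ![α, θ]) (i := 1) (by simpa using hθ)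
  rw [Fin.prod_univ_two, Fin.prod_univ_two] at h
  change _ * gaussGCirc ψ (α * θ) = gaussG ψ α * gaussG ψ θ at h
  rw [eq_div_iff (gaussGCirc_ne_zero hψ _), h]

/-- Lauricella's function as a sum over `F`. -/
theorem jacobiJ_pair_mul_lauricellaFD {ψ : AddChar F Qbar} (hψ : ψ ≠ 1) {n : ℕ}
    (α : MulChar F Qbar) {θ : MulChar F Qbar} (hθ : θ ≠ 1) {β : Fin n → MulChar F Qbar}
    (hβ : ∀ i, β i ≠ 1) (z : Fin n → F) (hz : ∀ i, z i ≠ 0) :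
    jacobiJ ![α, θ] * lauricellaFD ψ α β (α * θ) z =
      -∑ x, (∏ i, (β i)⁻¹ (1 - z i * x)) * α x * θ (1 - x) := by
  classical
  have hJ (ν : MulChar F Qbar) :
      jacobiJ ![α * ν, θ] = jacobiJ ![α, θ] * poch ψ α ν / pochCirc ψ (α * θ) ν := by
    rw [jacobiJ_pair_eq hψ _ hθ, jacobiJ_pair_eq hψ _ hθ, mul_right_comm α ν]
    simp only [poch, pochCirc]
    have h1 := gaussG_ne_zero hψ α
    have h2 := gaussGCirc_ne_zero hψ (α * θ)
    have h3 := gaussGCirc_ne_zero hψ (α * θ * ν)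
    field_simp
  have hx (x : F) :
      (∏ i, (β i)⁻¹ (1 - z i * x)) * α x * θ (1 - x) =
        1 / (1 - (Fintype.card F : Qbar)) ^ n * ∑ ν : Fin n → MulChar F Qbar,
          (∏ i, poch ψ (β i) (ν i) / pochCirc ψ 1 (ν i) * ν i (z i)) *
            ((α * ∏ i, ν i) x * θ (1 - x)) := by
    by_cases h0 : x = 0
    · simp only [h0, MulChar.map_zero, zero_mul, mul_zero, Finset.sum_const_zero]
    · have h (i : Fin n) := sum_poch_mul hψ (hβ i) (z i * x) (mul_ne_zero (hz i) h0)
      have h' : (1 - (Fintype.card F : Qbar)) ^ n ≠ 0 := pow_ne_zero _ one_sub_card_ne_zero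
      have hprod : (1 - (Fintype.card F : Qbar)) ^ n * ∏ i, (β i)⁻¹ (1 - z i * x) =
          ∏ i, ∑ ν : MulChar F Qbar, poch ψ (β i) ν / pochCirc ψ 1 ν * ν (z i * x) := by
        simp only [h, Finset.prod_mul_distrib, Finset.prod_const, Finset.card_univ,
          Fintype.card_fin]
      rw [one_div, eq_inv_mul_iff_mul_eq₀ h', ← mul_assoc, ← mul_assoc, hprod,
        Finset.prod_univ_sum, Fintype.piFinset_univ, Finset.sum_mul, Finset.sum_mul]
      refine Finset.sum_congr rfl fun ν _ => ?_
      simp only [map_mul, MulChar.mul_apply, Finset.prod_mul_distrib,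
        mulChar_prod_apply _ _ _ h0]
      ring
  simp only [hx]
  rw [← Finset.mul_sum, Finset.sum_comm, lauricellaFD, mul_left_comm, ← mul_neg]
  congr 1
  rw [Finset.mul_sum, ← Finset.sum_neg_distrib]
  refine Finset.sum_congr rfl fun ν _ => ?_
  rw [← Finset.mul_sum, ← mul_neg, ← jacobiJ_pair, hJ]
  simp only [Finset.prod_mul_distrib, Finset.prod_div_distrib]
  have h1 : ∏ i, pochCirc ψ 1 (ν i) ≠ 0 := Finset.prod_ne_zero_iff.2 fun i _ =>
    div_ne_zero (gaussGCirc_ne_zero hψ _) (gaussGCirc_ne_zero hψ _)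
  have h2 : pochCirc ψ (α * θ) (∏ i, ν i) ≠ 0 :=
    div_ne_zero (gaussGCirc_ne_zero hψ _) (gaussGCirc_ne_zero hψ _)
  field_simp

end Integral

/-! ### The Hasse–Davenport relation -/

section PolyWeight

open Polynomial

variable {k : Type*} [Field k]

variable (χ : MulChar k Qbar) (ψ : AddChar k Qbar)

/-- The multiplicative function on monic polynomials whose value at `∏ (X - x_i)` is
`ψ (∑ x_i) χ (∏ x_i)`. -/
def polyWeight (f : k[X]) : Qbar := ψ (-f.nextCoeff) * χ ((-1) ^ f.natDegree * f.coeff 0)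

lemma polyWeight_one : polyWeight χ ψ 1 = 1 := by
  have : (1 : k[X]).nextCoeff = 0 := by
    rw [← C_1, nextCoeff_C_eq_zero]
  simp [polyWeight, this]

lemma polyWeight_mul {f g : k[X]} (hf : f.Monic) (hg : g.Monic) :
    polyWeight χ ψ (f * g) = polyWeight χ ψ f * polyWeight χ ψ g := by
  simp only [polyWeight, hf.nextCoeff_mul hg, hf.natDegree_mul hg, mul_coeff_zero, neg_add,
    AddChar.map_add_eq_mul, pow_add, map_mul]
  ring

lemma polyWeight_pow {f : k[X]} (hf : f.Monic) (e : ℕ) :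
    polyWeight χ ψ (f ^ e) = polyWeight χ ψ f ^ e := by
  induction e with
  | zero => simp [polyWeight_one]
  | succ e ih => rw [pow_succ, polyWeight_mul χ ψ (hf.pow e) hf, ih, pow_succ]

end PolyWeight

/-! ### The Euler product over monic polynomials -/

section HasseDavenport

open Polynomial

variable {k : Type*} [Field k] [Fintype k]

variable (k) in
lemma finite_monic_natDegree_eq (n : ℕ) : {f : k[X] | f.Monic ∧ f.natDegree = n}.Finite := by
  refine Set.Finite.of_injOn (f := fun f : k[X] => fun i : Fin (n + 1) => f.coeff i)
    (t := Set.univ) (fun _ _ => Set.mem_univ _) ?_ Set.finite_univ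
  intro f hf g hg h
  ext i
  by_cases hi : i < n + 1
  · exact congrFun h ⟨i, hi⟩
  · rw [coeff_eq_zero_of_natDegree_lt (by have := hf.2; omega),
      coeff_eq_zero_of_natDegree_lt (by have := hg.2; omega)]

variable (k) in
/-- The monic polynomials of degree `n`. -/
def monics (n : ℕ) : Finset k[X] := (finite_monic_natDegree_eq k n).toFinset

@[simp] lemma mem_monics {n : ℕ} {f : k[X]} : f ∈ monics k n ↔ f.Monic ∧ f.natDegree = n := by
  simp [monics]

open Classical in
variable (k) in
/-- The monic irreducible polynomials of degree `n`. -/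
def monicIrreds (n : ℕ) : Finset k[X] := (monics k n).filter Irreducible

lemma mem_monicIrreds {n : ℕ} {f : k[X]} :
    f ∈ monicIrreds k n ↔ (f.Monic ∧ f.natDegree = n) ∧ Irreducible f := by
  simp [monicIrreds]

variable (χ : MulChar k Qbar) (ψ : AddChar k Qbar)

/-- The sum of the weights of the monic polynomials of degree `n`. -/
def weightSum (n : ℕ) : Qbar := ∑ f ∈ monics k n, polyWeight χ ψ f

/-- The sum of `deg P * λ(P)^e` over the powers `P^e` of degree `n` of monic irreducibles `P`. -/
def primePowerSum (n : ℕ) : Qbar :=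
  ∑ d ∈ n.divisors, ∑ P ∈ monicIrreds k d, (d : Qbar) * polyWeight χ ψ P ^ (n / d)

lemma weightSum_zero : weightSum χ ψ 0 = 1 := by
  have : monics k 0 = {1} := by
    ext f
    simp only [mem_monics, Finset.mem_singleton]
    exact ⟨fun h => (Monic.natDegree_eq_zero h.1).1 h.2, fun h => h ▸ by simp⟩
  rw [weightSum, this, Finset.sum_singleton, polyWeight_one]

lemma weightSum_one : weightSum χ ψ 1 = gaussSum χ ψ := by
  symm
  refine Finset.sum_bij (fun x _ => X - C x) ?_ ?_ ?_ ?_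
  · intro x _
    simp [monic_X_sub_C]
  · intro x _ y _ h
    simpa using h
  · intro f hf
    rw [mem_monics] at hf
    refine ⟨-f.coeff 0, Finset.mem_univ _, ?_⟩
    rw [C_neg, sub_neg_eq_add]
    exact (hf.1.eq_X_add_C hf.2).symm
  · intro x _
    simp [polyWeight, nextCoeff_X_sub_C, mul_comm]

/-- Translating the coefficient of `X^(n-1)` permutes the monic polynomials of degree `n` and
multiplies the sum by `ψ t ≠ 1`. For `n ≥ 2` that coefficient is not the constant one, so the factor
with `χ` is unaffected. -/
lemma weightSum_eq_zero {ψ : AddChar k Qbar} (hψ : ψ ≠ 1) {n : ℕ} (hn : 2 ≤ n) :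
    weightSum χ ψ n = 0 := by
  obtain ⟨t, ht⟩ := AddChar.ne_one_iff.1 hψ
  have hdeg : ∀ s : k, ∀ f ∈ monics k n, (f + C s * X ^ (n - 1)) ∈ monics k n := by
    intro s f hf
    rw [mem_monics] at hf ⊢
    have hlt : (C s * X ^ (n - 1)).degree < f.degree := by
      rw [degree_eq_natDegree hf.1.ne_zero, hf.2]
      refine (degree_C_mul_X_pow_le _ _).trans_lt ?_
      exact_mod_cast (by omega : n - 1 < n)
    exact ⟨hf.1.add_of_left hlt, by rw [natDegree_add_eq_left_of_degree_lt hlt, hf.2]⟩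
  refine eq_zero_of_mul_eq_self_left ht ?_
  rw [weightSum, Finset.mul_sum]
  refine Finset.sum_bij' (fun f _ => f + C (-t) * X ^ (n - 1)) (fun f _ => f + C t * X ^ (n - 1))
    (hdeg _) (hdeg _) ?_ ?_ ?_
  · intro f _; rw [C_neg]; ring
  · intro f _; rw [C_neg]; ring
  · intro f hf
    have h1 := mem_monics.1 hf
    have h2 := mem_monics.1 (hdeg (-t) f hf)
    rw [polyWeight, polyWeight, nextCoeff_of_natDegree_pos (by omega),
      nextCoeff_of_natDegree_pos (by omega), h1.2, h2.2, coeff_add, coeff_add, coeff_C_mul,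
      coeff_C_mul, coeff_X_pow, coeff_X_pow, if_pos rfl, if_neg (by omega), mul_one, mul_zero,
      add_zero, neg_add, neg_neg, AddChar.map_add_eq_mul]
    ring

open Classical in
lemma sum_polyWeight_dvd {n e d : ℕ} {P : k[X]} (hP : P ∈ monicIrreds k d) :
    ∑ f ∈ monics k n with P ^ e ∣ f, polyWeight χ ψ f =
      if e * d ≤ n then polyWeight χ ψ P ^ e * weightSum χ ψ (n - e * d) else 0 := by
  rw [mem_monicIrreds] at hP
  obtain ⟨⟨hPm, hPd⟩, -⟩ := hP
  have hdeg : (P ^ e).natDegree = e * d := by rw [hPm.natDegree_pow, hPd]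
  split_ifs with h
  · rw [weightSum, Finset.mul_sum]
    symm
    refine Finset.sum_bij (fun g _ => P ^ e * g) ?_ ?_ ?_ ?_
    · intro g hg
      rw [mem_monics] at hg
      rw [Finset.mem_filter, mem_monics]
      refine ⟨⟨(hPm.pow e).mul hg.1, ?_⟩, dvd_mul_right _ _⟩
      rw [(hPm.pow e).natDegree_mul hg.1, hdeg, hg.2]
      omega
    · intro f _ g _ hfg
      exact mul_left_cancel₀ (hPm.pow e).ne_zero hfg
    · intro f hf
      rw [Finset.mem_filter, mem_monics] at hf
      obtain ⟨⟨hfm, hfd⟩, g, rfl⟩ := hf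
      have hg : g.Monic := (hPm.pow e).of_mul_monic_left hfm
      refine ⟨g, ?_, rfl⟩
      rw [(hPm.pow e).natDegree_mul hg, hdeg] at hfd
      exact mem_monics.2 ⟨hg, by omega⟩
    · intro g hg
      rw [polyWeight_mul χ ψ (hPm.pow e) (mem_monics.1 hg).1, polyWeight_pow χ ψ hPm]
  · refine Finset.sum_eq_zero fun f hf => ?_
    rw [Finset.mem_filter, mem_monics] at hf
    have := natDegree_le_of_dvd hf.2 hf.1.1.ne_zero
    omega

open Classical in
-- The degree of `f` is the sum of `deg P` times the multiplicity of `P`, and the multiplicity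
-- counts the `e ≥ 1` with `P ^ e ∣ f`. In this form the sums over `f` and over prime powers can be
-- exchanged.
lemma natDegree_eq_sum_monicIrreds {n : ℕ} {f : k[X]} (hf : f ∈ monics k n) :
    n = ∑ d ∈ Finset.Icc 1 n, ∑ P ∈ monicIrreds k d, ∑ _e ∈ Finset.Icc 1 n with P ^ _e ∣ f, d := by
  obtain ⟨hfm, hfd⟩ := mem_monics.1 hf
  have hf0 := hfm.ne_zero
  set s := UniqueFactorizationMonoid.normalizedFactors f with hs
  have hmem {P : k[X]} : P ∈ s ↔ Irreducible P ∧ P.Monic ∧ P ∣ f := Polynomial.mem_normalizedFactors_iff hf0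
  have hprod : s.prod = f := by
    have := leadingCoeff_mul_prod_normalizedFactors f
    rwa [hfm.leadingCoeff, C_1, one_mul] at this
  have hdeg : n = ∑ P ∈ s.toFinset, s.count P * P.natDegree := by
    rw [← hfd]
    conv_lhs => rw [← hprod, natDegree_multiset_prod_of_monic s fun P hP => (hmem.1 hP).2.1,
      Finset.sum_multiset_map_count]
    simp
  have hcount {P : k[X]} (hP : Irreducible P) (hPm : P.Monic) (e : ℕ) :
      P ^ e ∣ f ↔ e ≤ s.count P := by
    rw [pow_dvd_iff_le_emultiplicity,
      UniqueFactorizationMonoid.emultiplicity_eq_count_normalizedFactors hP hf0, hPm.normalize_eq_self]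
    exact Nat.cast_le
  have hmaps : ∀ P ∈ s.toFinset, P.natDegree ∈ Finset.Icc 1 n := by
    intro P hP
    obtain ⟨h1, -, h3⟩ := hmem.1 (Multiset.mem_toFinset.1 hP)
    exact Finset.mem_Icc.2 ⟨h1.natDegree_pos, hfd ▸ natDegree_le_of_dvd h3 hf0⟩
  conv_lhs => rw [hdeg, ← Finset.sum_fiberwise_of_maps_to hmaps]
  refine Finset.sum_congr rfl fun d hd => ?_
  have hd1 := (Finset.mem_Icc.1 hd).1
  have hcard : ∀ P ∈ monicIrreds k d, s.count P * d = ∑ _e ∈ Finset.Icc 1 n with P ^ _e ∣ f, d := by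
    intro P hP
    obtain ⟨⟨hPm, hPd⟩, hPi⟩ := mem_monicIrreds.1 hP
    -- Multiplicities are at most `n`, so the cutoff `e ≤ n` loses nothing.
    have hle : s.count P ≤ n := by
      have h := natDegree_le_of_dvd ((hcount hPi hPm _).2 le_rfl) hf0
      rw [hPm.natDegree_pow, hPd, hfd] at h
      exact (Nat.le_mul_of_pos_right _ hd1).trans h
    have : (Finset.Icc 1 n).filter (fun e => P ^ e ∣ f) = Finset.Icc 1 (s.count P) := by
      ext e
      simp only [Finset.mem_filter, Finset.mem_Icc, hcount hPi hPm]
      omega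
    rw [this, Finset.sum_const, Nat.card_Icc]
    simp
  rw [← Finset.sum_congr rfl hcard]
  have hsub : s.toFinset.filter (fun P => P.natDegree = d) ⊆ monicIrreds k d := by
    intro P hP
    obtain ⟨h1, h2⟩ := Finset.mem_filter.1 hP
    obtain ⟨h3, h4, -⟩ := hmem.1 (Multiset.mem_toFinset.1 h1)
    exact mem_monicIrreds.2 ⟨⟨h4, h2⟩, h3⟩
  rw [← Finset.sum_subset hsub]
  · exact Finset.sum_congr rfl fun P hP => by rw [(Finset.mem_filter.1 hP).2]
  · intro P hP hP'
    have : P ∉ s := fun h =>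
      hP' (Finset.mem_filter.2 ⟨Multiset.mem_toFinset.2 h, (mem_monicIrreds.1 hP).1.2⟩)
    rw [Multiset.count_eq_zero_of_notMem this, zero_mul]

/-- The recursion that expresses the logarithmic derivative of the Euler product. -/
lemma natCast_mul_weightSum (n : ℕ) :
    (n : Qbar) * weightSum χ ψ n =
      ∑ j ∈ Finset.Icc 1 n, primePowerSum χ ψ j * weightSum χ ψ (n - j) := by
  classical
  -- Both sides become sums over triples `(d, P, e)` with `deg P = d` and `e * d ≤ n`; on the right
  -- `j = e * d`.
  have hL : (n : Qbar) * weightSum χ ψ n = ∑ d ∈ Finset.Icc 1 n, ∑ P ∈ monicIrreds k d,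
      ∑ e ∈ Finset.Icc 1 n with e * d ≤ n,
        (d : Qbar) * polyWeight χ ψ P ^ e * weightSum χ ψ (n - e * d) := by
    have h1 : (n : Qbar) * weightSum χ ψ n = ∑ f ∈ monics k n, ∑ d ∈ Finset.Icc 1 n,
        ∑ P ∈ monicIrreds k d, ∑ e ∈ Finset.Icc 1 n,
          if P ^ e ∣ f then (d : Qbar) * polyWeight χ ψ f else 0 := by
      rw [weightSum, Finset.mul_sum]
      refine Finset.sum_congr rfl fun f hf => ?_
      conv_lhs => rw [natDegree_eq_sum_monicIrreds hf]
      simp only [Nat.cast_sum, Finset.sum_mul, Finset.sum_filter, Nat.cast_ite, Nat.cast_zero,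
        ite_mul, zero_mul]
    rw [h1, Finset.sum_comm]
    refine Finset.sum_congr rfl fun d _ => ?_
    rw [Finset.sum_comm]
    refine Finset.sum_congr rfl fun P hP => ?_
    rw [Finset.sum_comm, Finset.sum_filter]
    refine Finset.sum_congr rfl fun e _ => ?_
    rw [← Finset.sum_filter, ← Finset.mul_sum, sum_polyWeight_dvd χ ψ hP, mul_ite, mul_zero,
      mul_assoc]
  have hR : ∑ j ∈ Finset.Icc 1 n, primePowerSum χ ψ j * weightSum χ ψ (n - j) =
      ∑ d ∈ Finset.Icc 1 n, ∑ j ∈ Finset.Icc 1 n with d ∣ j,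
        (∑ P ∈ monicIrreds k d, (d : Qbar) * polyWeight χ ψ P ^ (j / d)) *
          weightSum χ ψ (n - j) := by
    simp only [primePowerSum, Finset.sum_mul (Nat.divisors _)]
    refine Finset.sum_comm' fun j d => ?_
    simp only [Finset.mem_Icc, Nat.mem_divisors, Finset.mem_filter]
    constructor
    · rintro ⟨⟨h1, h2⟩, h3, h4⟩
      exact ⟨⟨⟨h1, h2⟩, h3⟩, Nat.pos_of_dvd_of_pos h3 h1, (Nat.le_of_dvd h1 h3).trans h2⟩
    · rintro ⟨⟨⟨h1, h2⟩, h3⟩, -, -⟩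
      exact ⟨⟨h1, h2⟩, h3, by omega⟩
  rw [hL, hR]
  refine Finset.sum_congr rfl fun d hd => ?_
  have hd1 : 0 < d := (Finset.mem_Icc.1 hd).1
  simp only [Finset.sum_mul]
  rw [Finset.sum_comm (s := Finset.filter _ _)]
  refine Finset.sum_congr rfl fun P _ => ?_
  refine Finset.sum_bij' (fun e _ => e * d) (fun j _ => j / d) ?_ ?_ ?_ ?_ ?_
  · intro e he
    simp only [Finset.mem_filter, Finset.mem_Icc] at he ⊢
    exact ⟨⟨Nat.mul_pos he.1.1 hd1, he.2⟩, dvd_mul_left _ _⟩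
  · intro j hj
    simp only [Finset.mem_filter, Finset.mem_Icc] at hj ⊢
    rw [Nat.div_mul_cancel hj.2]
    exact ⟨⟨Nat.div_pos (Nat.le_of_dvd hj.1.1 hj.2) hd1, (Nat.div_le_self _ _).trans hj.1.2⟩,
      hj.1.2⟩
  · intro e _
    exact Nat.mul_div_cancel e hd1
  · intro j hj
    exact Nat.div_mul_cancel (Finset.mem_filter.1 hj).2
  · intro e _
    rw [Nat.mul_div_cancel e hd1]

lemma neg_primePowerSum {ψ : AddChar k Qbar} (hψ : ψ ≠ 1) {n : ℕ} (hn : 1 ≤ n) :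
    -primePowerSum χ ψ n = gaussG ψ χ ^ n := by
  induction n, hn using Nat.le_induction with
  | base =>
    have h := natCast_mul_weightSum χ ψ 1
    simp only [Finset.Icc_self, Finset.sum_singleton, Nat.sub_self, weightSum_zero, mul_one,
      weightSum_one, Nat.cast_one, one_mul] at h
    rw [← h, gaussG, pow_one]
  | succ n hn ih =>
    have h := natCast_mul_weightSum χ ψ (n + 1)
    -- Only `j = n` and `j = n + 1` survive, because `weightSum` vanishes from degree `2` on. What
    -- is left is a two-term recursion with ratio minus the Gauss sum.
    rw [weightSum_eq_zero χ hψ (by omega), mul_zero, Finset.sum_Icc_succ_top (by omega),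
      ← Nat.sub_add_cancel hn, Finset.sum_Icc_succ_top (by omega), Nat.sub_add_cancel hn,
      Finset.sum_eq_zero, Nat.sub_self, weightSum_zero, zero_add, Nat.add_sub_cancel_left,
      weightSum_one, mul_one] at h
    · rw [pow_succ, ← ih, gaussG, neg_mul_neg, eq_neg_of_add_eq_zero_left h.symm]
    · intro j hj
      rw [Finset.mem_Icc] at hj
      rw [weightSum_eq_zero χ hψ (by omega), mul_zero]

end HasseDavenport

/-! ### Characters lifted along the norm -/

section NormLift

open Polynomial IntermediateField

variable {k : Type*} [Field k] {L : Type*} [Field L] [Algebra k L]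

lemma normLift_apply [FiniteDimensional k L] (η : MulChar k Qbar) (x : L) :
    normLift L η x = η (Algebra.norm k x) := by
  by_cases hx : x = 0
  · rw [hx, Algebra.norm_zero, MulChar.map_zero, MulChar.map_zero]
  · lift x to Lˣ using isUnit_iff_ne_zero.2 hx
    simp [normLift]

lemma normLift_mul [FiniteDimensional k L] (η θ : MulChar k Qbar) :
    normLift L (η * θ) = normLift L η * normLift L θ := by
  ext x
  simp only [MulChar.mul_apply, normLift_apply]

lemma normLift_one [FiniteDimensional k L] : normLift L (1 : MulChar k Qbar) = 1 := by
  ext x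
  rw [normLift_apply, MulChar.one_apply_coe,
    MulChar.one_apply ((x.isUnit).map (Algebra.norm k))]

variable (k L) in
/-- `normLift` as a homomorphism. -/
def normLiftHom [FiniteDimensional k L] : MulChar k Qbar →* MulChar L Qbar where
  toFun := normLift L
  map_one' := normLift_one
  map_mul' := normLift_mul

lemma normLift_zpow [FiniteDimensional k L] (η : MulChar k Qbar) (m : ℤ) :
    normLift L (η ^ m) = normLift L η ^ m :=
  map_zpow (normLiftHom k L) η m

/-- From `k(x)` to `k`, the norm and trace of `x` are read off the minimal polynomial; the remaining
extension `L / k(x)` contributes its degree as an exponent. -/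
lemma polyWeight_minpoly [Finite L] (χ : MulChar k Qbar) (ψ : AddChar k Qbar) (x : L) :
    χ (Algebra.norm k x) * ψ (Algebra.trace k L x) =
      polyWeight χ ψ (minpoly k x) ^ (Module.finrank k L / (minpoly k x).natDegree) := by
  have hx : IsIntegral k x := .of_finite k x
  have hfin : Module.finrank k L / (minpoly k x).natDegree = Module.finrank k⟮x⟯ L := by
    rw [← Module.finrank_mul_finrank k k⟮x⟯ L, adjoin.finrank hx,
      Nat.mul_div_cancel_left _ (minpoly.natDegree_pos hx)]
  have hN := Algebra.PowerBasis.norm_gen_eq_coeff_zero_minpoly (adjoin.powerBasis hx)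
  rw [adjoin.powerBasis_gen, adjoin.powerBasis_dim, minpoly_gen] at hN
  rw [hfin, Algebra.norm_eq_norm_adjoin, trace_eq_finrank_mul_minpoly_nextCoeff, hN, polyWeight,
    map_pow, mul_pow, ← nsmul_eq_mul, AddChar.map_nsmul_eq_pow, mul_comm]

variable [Finite L]

lemma normLift_eq_one_iff [FiniteDimensional k L] (η : MulChar k Qbar) :
    normLift L η = 1 ↔ η = 1 := by
  refine ⟨fun h => ?_, fun h => h ▸ normLift_one⟩
  ext x
  obtain ⟨y, hy⟩ := FiniteField.unitsMap_norm_surjective k L x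
  have h1 := congrArg (fun f : MulChar L Qbar => f (y : L)) h
  simp only [normLift_apply, MulChar.one_apply_coe] at h1
  rw [MulChar.one_apply_coe, ← hy]
  exact h1

end NormLift

/-! ### Gauss and Jacobi sums over an extension -/

section HasseDavenport

open Polynomial IntermediateField

variable {k : Type*} [Field k] [Fintype k] {L : Type*} [Field L] [Fintype L] [Algebra k L]

open Classical in
-- The roots of `P` in `L` correspond to the embeddings of `k[X]/(P)` into `L`, and there are `d` of
-- these because `d` divides the degree of `L`.
lemma card_minpoly_eq {d : ℕ} (hd : d ∣ Module.finrank k L) {P : k[X]}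
    (hP : P ∈ monicIrreds k d) :
    (Finset.univ.filter fun x : L => minpoly k x = P).card = d := by
  obtain ⟨⟨hPm, hPd⟩, hPi⟩ := mem_monicIrreds.1 hP
  have : Fact (Irreducible P) := ⟨hPi⟩
  have hfin : Module.finrank k (AdjoinRoot P) = d := by
    rw [(AdjoinRoot.powerBasis hPm.ne_zero).finrank, AdjoinRoot.powerBasis_dim, hPd]
  have h := FiniteField.natCard_algHom_of_finrank_dvd (F := k) (K := AdjoinRoot P) (L := L)
    (by rw [hfin]; exact hd)
  rw [hfin, Nat.card_congr (AdjoinRoot.equiv L k P hPm.ne_zero)] at h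
  rw [← h, ← Fintype.card_subtype, Nat.card_eq_fintype_card]
  refine Fintype.card_congr (Equiv.subtypeEquivRight fun x => ?_)
  rw [mem_aroots]
  constructor
  · rintro rfl
    exact ⟨hPm.ne_zero, minpoly.aeval k x⟩
  · rintro ⟨-, h0⟩
    exact (minpoly.eq_of_irreducible_of_monic hPi h0 hPm).symm

/-- The sum over an extension field in terms of irreducible polynomials. -/
lemma gaussSum_normLift (χ : MulChar k Qbar) (ψ : AddChar k Qbar) :
    gaussSum (normLift L χ) (ψ.compAddMonoidHom (Algebra.trace k L).toAddMonoidHom) =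
      primePowerSum χ ψ (Module.finrank k L) := by
  classical
  have hmaps : ∀ x ∈ (Finset.univ : Finset L),
      minpoly k x ∈ (Module.finrank k L).divisors.biUnion (monicIrreds k) := by
    intro x _
    have hx : IsIntegral k x := .of_finite k x
    refine Finset.mem_biUnion.2 ⟨(minpoly k x).natDegree,
      Nat.mem_divisors.2 ⟨minpoly.degree_dvd hx, Module.finrank_pos.ne'⟩,
      mem_monicIrreds.2 ⟨⟨minpoly.monic hx, rfl⟩, minpoly.irreducible hx⟩⟩
  rw [gaussSum, ← Finset.sum_fiberwise_of_maps_to hmaps, Finset.sum_biUnion, primePowerSum]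
  · refine Finset.sum_congr rfl fun d hd => Finset.sum_congr rfl fun P hP => ?_
    rw [Finset.sum_congr rfl (g := fun _ => polyWeight χ ψ P ^ (Module.finrank k L / d)),
      Finset.sum_const, card_minpoly_eq (Nat.dvd_of_mem_divisors hd) hP, nsmul_eq_mul]
    intro x hx
    obtain rfl := (Finset.mem_filter.1 hx).2
    rw [normLift_apply, ← (mem_monicIrreds.1 hP).1.2, ← polyWeight_minpoly]
    rfl
  · intro d _ e _ hde
    rw [Function.onFun, Finset.disjoint_left]
    intro P h1 h2
    exact hde ((mem_monicIrreds.1 h1).1.2.symm.trans (mem_monicIrreds.1 h2).1.2)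

/-- The Hasse–Davenport relation. -/
theorem gaussG_normLift (χ : MulChar k Qbar) {ψ : AddChar k Qbar} (hψ : ψ ≠ 1) :
    gaussG (ψ.compAddMonoidHom (Algebra.trace k L).toAddMonoidHom) (normLift L χ) =
      gaussG ψ χ ^ Module.finrank k L := by
  rw [gaussG, gaussSum_normLift, neg_primePowerSum χ hψ Module.finrank_pos]

lemma compTrace_ne_one {ψ : AddChar k Qbar} (hψ : ψ ≠ 1) :
    ψ.compAddMonoidHom (Algebra.trace k L).toAddMonoidHom ≠ 1 := by
  obtain ⟨t, ht⟩ := AddChar.ne_one_iff.1 hψ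
  obtain ⟨x, rfl⟩ := Algebra.trace_surjective k L t
  exact AddChar.ne_one_iff.2 ⟨x, ht⟩

lemma gaussGCirc_normLift (χ : MulChar k Qbar) {ψ : AddChar k Qbar} (hψ : ψ ≠ 1) :
    gaussGCirc (ψ.compAddMonoidHom (Algebra.trace k L).toAddMonoidHom) (normLift L χ) =
      gaussGCirc ψ χ ^ Module.finrank k L := by
  by_cases h : χ = 1
  · subst h
    rw [normLift_one, gaussGCirc_one (compTrace_ne_one hψ), gaussGCirc_one hψ,
      Module.card_eq_pow_finrank (K := k) (V := L)]
    push_cast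
    rfl
  · rw [gaussGCirc_of_ne_one _ h, gaussGCirc_of_ne_one _ (by rwa [Ne, normLift_eq_one_iff]),
      gaussG_normLift χ hψ]

/-- The Hasse–Davenport relation for Jacobi sums. -/
theorem jacobiJ_normLift {ψ : AddChar k Qbar} (hψ : ψ ≠ 1) {n : ℕ}
    {η : Fin (n + 1) → MulChar k Qbar} {i : Fin (n + 1)} (hi : η i ≠ 1) :
    jacobiJ (fun i => normLift L (η i)) = jacobiJ η ^ Module.finrank k L := by
  have h := jacobiJ_mul_gaussGCirc hψ hi
  have hL := jacobiJ_mul_gaussGCirc (compTrace_ne_one (L := L) hψ)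
    (η := fun i => normLift L (η i)) (i := i) (by rwa [Ne, normLift_eq_one_iff])
  have hprod : ∏ i, normLift L (η i) = normLift L (∏ i, η i) :=
    (map_prod (normLiftHom k L) η Finset.univ).symm
  simp only [hprod, gaussG_normLift _ hψ, gaussGCirc_normLift _ hψ, Finset.prod_pow] at hL
  rw [← h, mul_pow] at hL
  exact mul_right_cancel₀ (pow_ne_zero _ (gaussGCirc_ne_zero hψ _)) hL

end HasseDavenport

/-! ### Points of `y^d = f(x)` -/

section Characters

variable {k : Type*} [Field k]

lemma toUnitHom_pow (η : MulChar k Qbar) (m : ℕ) (u : kˣ) :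
    (η ^ m).toUnitHom u = η.toUnitHom u ^ m := by
  have h := map_pow MulChar.mulEquivToUnitHom η m
  exact DFunLike.congr_fun h u

lemma toUnitHom_zpow (η : MulChar k Qbar) (m : ℤ) (u : kˣ) :
    (η ^ m).toUnitHom u = η.toUnitHom u ^ m := by
  have h := map_zpow MulChar.mulEquivToUnitHom η m
  exact DFunLike.congr_fun h u

lemma restrictRoots_zpow_eq_one (φ : MulChar k Qbar) {d : ℕ} {m : ℤ} (hm : (d : ℤ) ∣ m) :
    restrictRoots φ d ^ m = 1 := by
  obtain ⟨e, rfl⟩ := hm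
  ext1 g
  have hg : g ^ d = 1 := Subtype.ext ((mem_rootsOfUnity d (g : kˣ)).1 g.2)
  rw [MonoidHom.zpow_apply, ← map_zpow, zpow_mul, zpow_natCast, hg, one_zpow, map_one,
    MonoidHom.one_apply]

variable [Fintype k]

lemma charD_zpow_eq_one_iff {φ : MulChar k Qbar} (hφ : ∀ η : MulChar k Qbar, η ∈ Subgroup.zpowers φ)
    {d : ℕ} (hd : d ∣ Fintype.card k - 1) (j : ℤ) : charD φ d ^ j = 1 ↔ (d : ℤ) ∣ j := by
  classical
  have ho : orderOf φ = Fintype.card k - 1 := by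
    rw [orderOf_eq_card_of_forall_mem_zpowers hφ,
      MulChar.card_eq_card_units_of_hasEnoughRootsOfUnity, Nat.card_eq_fintype_card,
      Fintype.card_units]
  obtain ⟨e, he⟩ := hd
  have hpos : 0 < d * e := he ▸ Nat.sub_pos_of_lt Fintype.one_lt_card
  have hd0 : 0 < d := Nat.pos_of_mul_pos_right hpos
  have he0 : (e : ℤ) ≠ 0 := by
    have := Nat.pos_of_mul_pos_left hpos
    omega
  rw [charD, he, Nat.mul_div_cancel_left _ hd0, ← zpow_natCast, ← zpow_mul,
    ← orderOf_dvd_iff_zpow_eq_one, ho, he, Nat.cast_mul, mul_comm (d : ℤ),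
    mul_dvd_mul_iff_left he0]

/-- The `d`-th root of unity `u^((q - 1) / d)`. -/
def powToRoots {d : ℕ} (hd : d ∣ Fintype.card k - 1) (u : kˣ) : rootsOfUnity d k :=
  ⟨u ^ ((Fintype.card k - 1) / d), by
    rw [mem_rootsOfUnity, ← pow_mul, Nat.div_mul_cancel hd]
    exact Units.ext (by simpa using FiniteField.pow_card_sub_one_eq_one (u : k) u.ne_zero)⟩

/-- The link between `χ` on the roots of unity, which act on the variety, and `φ_d` on `kˣ`, which
enters the character sums. -/
lemma restrictRoots_powToRoots (φ : MulChar k Qbar) {d : ℕ} (hd : d ∣ Fintype.card k - 1) (m : ℤ)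
    (u : kˣ) : (restrictRoots φ d ^ m) (powToRoots hd u) = (charD φ d ^ m).toUnitHom u := by
  rw [MonoidHom.zpow_apply, toUnitHom_zpow, charD, toUnitHom_pow, ← map_pow]
  rfl

lemma restrictRoots_zpow_ne_one {φ : MulChar k Qbar}
    (hφ : ∀ η : MulChar k Qbar, η ∈ Subgroup.zpowers φ) {d : ℕ} (hd : d ∣ Fintype.card k - 1)
    {m : ℤ} (hm : ¬(d : ℤ) ∣ m) : restrictRoots φ d ^ m ≠ 1 := by
  intro h
  refine hm ((charD_zpow_eq_one_iff hφ hd m).1 ?_)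
  ext u
  rw [MulChar.one_apply_coe, ← MulChar.coe_toUnitHom, ← restrictRoots_powToRoots φ hd, h]
  rfl

variable (k) in
lemma exists_isPrimitiveRoot {d : ℕ} (hd : d ∣ Fintype.card k - 1) :
    ∃ ζ : k, IsPrimitiveRoot ζ d := by
  classical
  obtain ⟨e, he⟩ := hd
  have hpos : 0 < Fintype.card k - 1 := Nat.sub_pos_of_lt Fintype.one_lt_card
  obtain ⟨g, hg⟩ := IsCyclic.exists_ofOrder_eq_natCard (α := kˣ)
  rw [Nat.card_eq_fintype_card, Fintype.card_units] at hg
  have h : IsPrimitiveRoot (g : k) (Fintype.card k - 1) :=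
    (hg ▸ IsPrimitiveRoot.orderOf g).map_of_injective (f := Units.coeHom k) Units.val_injective
  exact ⟨_, h.pow hpos (by rw [he, mul_comm])⟩

lemma natCard_rootsOfUnity {d : ℕ} [NeZero d] (hd : d ∣ Fintype.card k - 1) :
    Nat.card (rootsOfUnity d k) = d := by
  obtain ⟨ζ, hζ⟩ := exists_isPrimitiveRoot k hd
  exact hζ.card_rootsOfUnity

end Characters

/-! ### Rational points and fibres over an intermediate field -/

section IntermediateFieldPoints

variable {k : Type*} [Field k] {kbar : Type*} [Field kbar] [Algebra k kbar]

/-- `X^(#K) - X` already splits over `K`, so it has no further roots in `kbar`. -/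
lemma mem_intermediateField_iff (K : IntermediateField k kbar) [Fintype K] (x : kbar) :
    x ∈ K ↔ x ^ Fintype.card K = x := by
  classical
  refine ⟨fun hx => ?_, fun hx => ?_⟩
  · simpa using congrArg Subtype.val (FiniteField.pow_card (⟨x, hx⟩ : K))
  · have h := FiniteField.roots_X_pow_card_sub_X K
    have hs : ((Polynomial.X ^ Fintype.card K - Polynomial.X : Polynomial K)).Splits := by
      rw [Polynomial.splits_iff_card_roots, h,
        FiniteField.X_pow_card_sub_X_natDegree_eq _ Fintype.one_lt_card]
      rfl
    have h2 := hs.roots_map (algebraMap K kbar)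
    rw [h] at h2
    have hmem : x ∈ ((Polynomial.X ^ Fintype.card K - Polynomial.X : Polynomial K).map
        (algebraMap K kbar)).roots := by
      rw [Polynomial.mem_roots (Polynomial.map_ne_zero
        (FiniteField.X_pow_card_sub_X_ne_zero _ Fintype.one_lt_card))]
      simp [hx]
    rw [h2, Multiset.mem_map] at hmem
    obtain ⟨y, -, rfl⟩ := hmem
    exact y.2

lemma coe_aeval (K : IntermediateField k kbar) {σ : Type*} (f : MvPolynomial σ k) (x : σ → K) :
    ((MvPolynomial.aeval x f : K) : kbar) = MvPolynomial.aeval (fun i => (x i : kbar)) f :=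
  MvPolynomial.comp_aeval_apply x K.val f

lemma natCard_fiber_zero (K : IntermediateField k kbar) [Fintype K] {d : ℕ} [NeZero d] (c : kbar) :
    Nat.card {y : kbar // y ^ d = ((0 : K) : kbar) ∧ y ^ Fintype.card K = c * y} = 1 := by
  rw [Nat.card_eq_one_iff_unique]
  refine ⟨⟨fun y z => Subtype.ext ?_⟩, ⟨⟨0, ?_, ?_⟩⟩⟩
  · have hy := y.2.1
    have hz := z.2.1
    simp only [ZeroMemClass.coe_zero] at hy hz
    rw [eq_zero_of_pow_eq_zero hy, eq_zero_of_pow_eq_zero hz]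
  · simp [NeZero.ne d]
  · simp

end IntermediateFieldPoints

section Points

variable {k : Type*} [Field k] [Fintype k] {kbar : Type*} [Field kbar] [Algebra k kbar]

lemma frob_iterate_val {σ : Type*} {d : ℕ} {f : MvPolynomial σ k} (P : CoverPoints kbar d f)
    (r : ℕ) : (CoverPoints.frob^[r] P).1 =
      (fun i => P.1.1 i ^ Fintype.card k ^ r, P.1.2 ^ Fintype.card k ^ r) := by
  induction r with
  | zero => simp
  | succ r ih =>
    rw [Function.iterate_succ_apply']
    change (fun i => (CoverPoints.frob^[r] P).1.1 i ^ Fintype.card k,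
      (CoverPoints.frob^[r] P).1.2 ^ Fintype.card k) = _
    rw [ih]
    simp only [← pow_mul, ← pow_succ]

variable (K : IntermediateField k kbar) [Fintype K]

/-- With `Q = #K`, the norm of `u` is `u^((Q-1)/(q-1))`, and `u = y^d`. So the Frobenius multiplier
of `y` depends on `u` alone. -/
lemma pow_card_sub_one_eq {d : ℕ} (hd : d ∣ Fintype.card k - 1) {u : K} {y : kbar}
    (hy : y ^ d = u) :
    y ^ (Fintype.card K - 1) =
      algebraMap k kbar (Algebra.norm k u ^ ((Fintype.card k - 1) / d)) := by
  have hdvd : Fintype.card k - 1 ∣ Fintype.card K - 1 := by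
    rw [Module.card_eq_pow_finrank (K := k) (V := K)]
    simpa using Nat.sub_dvd_pow_sub_pow (Fintype.card k) 1 (Module.finrank k K)
  have h := congrArg (algebraMap K kbar) (FiniteField.algebraMap_norm_eq_pow (K := k) (x := u))
  rw [← IsScalarTower.algebraMap_apply, map_pow, Nat.card_eq_fintype_card,
    Nat.card_eq_fintype_card] at h
  rw [map_pow, h]
  change _ = (((u : K) : kbar) ^ _) ^ _
  rw [← hy, ← pow_mul, ← pow_mul]
  congr 1
  obtain ⟨e, he⟩ := hd
  obtain ⟨e', he'⟩ := hdvd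
  have hpos : 0 < Fintype.card k - 1 := Nat.sub_pos_of_lt Fintype.one_lt_card
  have hd0 : 0 < d := Nat.pos_of_mul_pos_right (he ▸ hpos)
  rw [he', Nat.mul_div_cancel_left _ hpos, he, Nat.mul_div_cancel_left _ hd0]
  ring

/-- The points on which a power of Frobenius acts as a root of unity, fibred over `K^σ`. -/
def twistedPointsEquiv {σ : Type*} {d : ℕ} (f : MvPolynomial σ k) (r : ℕ)
    (hr : Fintype.card K = Fintype.card k ^ r) (g : rootsOfUnity d k) :
    {P : CoverPoints kbar d f // CoverPoints.frob^[r] P = g • P} ≃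
      Σ x : σ → K, {y : kbar // y ^ d = (MvPolynomial.aeval x f : K) ∧
        y ^ Fintype.card K = algebraMap k kbar ((g : kˣ) : k) * y} where
  toFun P := ⟨fun i => ⟨P.1.1.1 i, by
      have h := congrArg (fun Q : CoverPoints kbar d f => Q.1.1 i) P.2
      simp only [frob_iterate_val] at h
      rw [mem_intermediateField_iff, hr]
      exact h⟩, P.1.1.2, by
      rw [coe_aeval]
      exact P.1.2, by
      have h := congrArg (fun Q : CoverPoints kbar d f => Q.1.2) P.2
      simp only [frob_iterate_val] at h
      rw [hr]
      exact h⟩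
  invFun Q := ⟨⟨(fun i => (Q.1 i : kbar), Q.2.1), by
      rw [← coe_aeval]
      exact Q.2.2.1⟩, by
      refine Subtype.ext ?_
      refine (frob_iterate_val _ r).trans (Prod.ext (funext fun i => ?_) ?_)
      · exact hr ▸ (mem_intermediateField_iff K _).1 (Q.1 i).2
      · exact hr ▸ Q.2.2.2⟩
  left_inv P := rfl
  right_inv Q := rfl

end Points

section Roots

variable {kbar : Type*} [Field kbar]

/-- Finite fibres are needed for `Nat.card` to be additive over them. -/
lemma finite_pow_eq {d : ℕ} [NeZero d] (u : kbar) (p : kbar → Prop) :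
    Finite {y : kbar // y ^ d = u ∧ p y} := by
  have : {y : kbar | y ^ d = u ∧ p y} ⊆ {y : kbar | y ∈ Polynomial.nthRoots d u} := fun y hy =>
    (Polynomial.mem_nthRoots (NeZero.pos d)).2 hy.1
  exact ((Multiset.finite_toSet (Polynomial.nthRoots d u)).subset this).to_subtype

lemma natCard_pow_eq [IsAlgClosed kbar] {d : ℕ} [NeZero d] {ζ : kbar} (hζ : IsPrimitiveRoot ζ d)
    {u : kbar} (hu : u ≠ 0) : Nat.card {y : kbar // y ^ d = u} = d := by
  classical
  obtain ⟨α, hα⟩ := IsAlgClosed.exists_pow_nat_eq u (NeZero.pos d)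
  have h := hζ.card_nthRoots u
  rw [if_pos ⟨α, hα⟩, ← Multiset.toFinset_card_of_nodup (hζ.nthRoots_nodup hu)] at h
  rw [Nat.subtype_card (Polynomial.nthRoots d u).toFinset, h]
  intro y
  rw [Multiset.mem_toFinset, Polynomial.mem_nthRoots (NeZero.pos d)]

end Roots

section Count

variable {k : Type*} [Field k] [Fintype k] {kbar : Type*} [Field kbar] [Algebra k kbar]
  (K : IntermediateField k kbar) [Fintype K]

lemma twistedCount_eq_sum {σ : Type*} [Fintype σ] [DecidableEq σ] {d : ℕ} [NeZero d]
    [Fintype (rootsOfUnity d k)] (f : MvPolynomial σ k) (χ : rootsOfUnity d k →* Qbarˣ) (r : ℕ+) (hr : Module.finrank k K = r) :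
    twistedCount (CoverPoints.frob : CoverPoints kbar d f → _) χ r =
      1 / (Nat.card (rootsOfUnity d k) : Qbar) * ∑ x : σ → K, ∑ g : rootsOfUnity d k,
        (χ g : Qbar) * Nat.card {y : kbar // y ^ d = ((MvPolynomial.aeval x f : K) : kbar) ∧
          y ^ Fintype.card K = algebraMap k kbar ((g : kˣ) : k) * y} := by
  classical
  have hcard : Fintype.card K = Fintype.card k ^ (r : ℕ) := by
    rw [← hr]
    exact Module.card_eq_pow_finrank
  rw [twistedCount, finsum_eq_sum_of_fintype, Finset.sum_comm]
  congr 1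
  refine Finset.sum_congr rfl fun g _ => ?_
  have (x : σ → K) := finite_pow_eq (d := d) ((MvPolynomial.aeval x f : K) : kbar)
    (fun y => y ^ Fintype.card K = algebraMap k kbar ((g : kˣ) : k) * y)
  rw [Nat.card_congr (twistedPointsEquiv K f r hcard g), Nat.card_sigma, Nat.cast_sum,
    Finset.mul_sum]

variable [IsAlgClosed kbar]

open Classical in
lemma natCard_fiber_unit {d : ℕ} [NeZero d] (hd : d ∣ Fintype.card k - 1) (u : Kˣ)
    (g : rootsOfUnity d k) :
    Nat.card {y : kbar // y ^ d = ((u : K) : kbar) ∧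
        y ^ Fintype.card K = algebraMap k kbar ((g : kˣ) : k) * y} =
      if g = powToRoots hd (Units.map (Algebra.norm k : K →* k) u) then d else 0 := by
  obtain ⟨ζ, hζ⟩ := exists_isPrimitiveRoot k hd
  have hu : ((u : K) : kbar) ≠ 0 := by simp
  have hiff (y : kbar) (hy : y ^ d = ((u : K) : kbar)) :
      y ^ Fintype.card K = algebraMap k kbar ((g : kˣ) : k) * y ↔
        g = powToRoots hd (Units.map (Algebra.norm k : K →* k) u) := by
    have hy0 : y ≠ 0 := by
      rintro rfl
      exact hu (by rw [← hy, zero_pow (NeZero.ne d)])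
    have h1 : y ^ Fintype.card K = y ^ (Fintype.card K - 1) * y := by
      rw [← pow_succ, Nat.sub_add_cancel Fintype.card_pos]
    rw [h1, mul_left_inj' hy0, pow_card_sub_one_eq K hd hy, (algebraMap k kbar).injective.eq_iff,
      Subtype.ext_iff, Units.ext_iff, eq_comm]
    rfl
  split_ifs with h
  · refine Eq.trans ?_
      (natCard_pow_eq (hζ.map_of_injective (algebraMap k kbar).injective) hu)
    exact Nat.card_congr (Equiv.subtypeEquivRight fun y =>
      ⟨fun hy => hy.1, fun hy => ⟨hy, (hiff y hy).2 h⟩⟩)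
  · rw [Nat.card_eq_zero]
    exact .inl ⟨fun y => h ((hiff y.1 y.2.1).1 y.2.2)⟩

/-- Every fibre contributes `d`: for `u ≠ 0`, one `g` carries all `d` points; for `u = 0`, each of
the `d` elements `g` carries one point. -/
lemma twistedCount_one {σ : Type*} [Fintype σ] [DecidableEq σ] {d : ℕ} [NeZero d]
    (hd : d ∣ Fintype.card k - 1) (f : MvPolynomial σ k) (r : ℕ+)
    (hr : Module.finrank k K = r) :
    twistedCount (CoverPoints.frob : CoverPoints kbar d f → _)
      (1 : rootsOfUnity d k →* Qbarˣ) r = ((Fintype.card k : Qbar) ^ Fintype.card σ) ^ (r : ℕ) := by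
  classical
  have := Fintype.ofFinite (rootsOfUnity d k)
  have hd0 : (d : Qbar) ≠ 0 := by exact_mod_cast NeZero.ne d
  have hfib (u : K) : ∑ g : rootsOfUnity d k, ((1 : rootsOfUnity d k →* Qbarˣ) g : Qbar) *
      Nat.card {y : kbar // y ^ d = (u : kbar) ∧
        y ^ Fintype.card K = algebraMap k kbar ((g : kˣ) : k) * y} = d := by
    by_cases hu : u = 0
    · subst hu
      simp only [natCard_fiber_zero, MonoidHom.one_apply, Units.val_one, Nat.cast_one, mul_one,
        Finset.sum_const, Finset.card_univ, nsmul_eq_mul]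
      rw [← Nat.card_eq_fintype_card, natCard_rootsOfUnity hd]
    · lift u to Kˣ using isUnit_iff_ne_zero.2 hu
      simp [natCard_fiber_unit K hd]
  rw [twistedCount_eq_sum K f 1 r hr, natCard_rootsOfUnity hd]
  simp only [hfib, Finset.sum_const, Finset.card_univ, nsmul_eq_mul, Fintype.card_fun]
  rw [mul_left_comm, one_div_mul_cancel hd0, mul_one,
    Module.card_eq_pow_finrank (K := k) (V := K), hr]
  push_cast
  rw [← pow_mul, ← pow_mul, mul_comm]

lemma twistedCount_zpow {σ : Type*} [Fintype σ] [DecidableEq σ] {d : ℕ} [NeZero d]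
    (hd : d ∣ Fintype.card k - 1) (f : MvPolynomial σ k) {φ : MulChar k Qbar}
    (hφ : ∀ η : MulChar k Qbar, η ∈ Subgroup.zpowers φ) {m : ℤ} (hm : ¬(d : ℤ) ∣ m) (r : ℕ+)
    (hr : Module.finrank k K = r) :
    twistedCount (CoverPoints.frob : CoverPoints kbar d f → _) (restrictRoots φ d ^ m) r =
      ∑ x : σ → K, (normLift K (charD φ d) ^ m) (MvPolynomial.aeval x f) := by
  classical
  have := Fintype.ofFinite (rootsOfUnity d k)
  have hd0 : (d : Qbar) ≠ 0 := by exact_mod_cast NeZero.ne d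
  -- This kills the fibre over `0`, in agreement with the convention `η(0) = 0`.
  have hsum : ∑ g : rootsOfUnity d k, ((restrictRoots φ d ^ m) g : Qbar) = 0 := by
    refine sum_hom_units_eq_zero ((Units.coeHom Qbar).comp (restrictRoots φ d ^ m)) fun h => ?_
    refine restrictRoots_zpow_ne_one hφ hd hm ?_
    ext g
    exact DFunLike.congr_fun h g
  have hfib (u : K) : ∑ g : rootsOfUnity d k, ((restrictRoots φ d ^ m) g : Qbar) *
      Nat.card {y : kbar // y ^ d = (u : kbar) ∧
        y ^ Fintype.card K = algebraMap k kbar ((g : kˣ) : k) * y} =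
      d * (normLift K (charD φ d) ^ m) u := by
    by_cases hu : u = 0
    · subst hu
      simp only [natCard_fiber_zero, Nat.cast_one, mul_one, hsum, MulChar.map_zero, mul_zero]
    · lift u to Kˣ using isUnit_iff_ne_zero.2 hu
      simp only [natCard_fiber_unit K hd, Nat.cast_ite, Nat.cast_zero, mul_ite, mul_zero,
        Finset.sum_ite_eq', Finset.mem_univ, if_true]
      rw [restrictRoots_powToRoots, ← normLift_zpow, normLift_apply, MulChar.coe_toUnitHom,
        mul_comm]
      rfl
  rw [twistedCount_eq_sum K f _ r hr, natCard_rootsOfUnity hd]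
  simp only [hfib]
  rw [← Finset.mul_sum, ← mul_assoc, one_div_mul_cancel hd0, one_mul]

end Count

/-! ### The varieties `C_{D,l}` and `S_{D,l}` -/

section Evaluation

variable {k : Type*} [Field k] {F : Type*} [Field F] [Algebra k F]

/-- For `b = 0` and `u = 0` the left side would be `1` and the right side `0`; hence the positivity
of the exponents. -/
lemma mulChar_pow_eq_zpow (η : MulChar F Qbar) {m : ℤ} {b : ℕ} (hb : 0 < b) (u : F) :
    (η ^ m) (u ^ b) = (η ^ (m * b)) u := by
  rw [zpow_mul, zpow_natCast, MulChar.pow_apply' _ hb.ne', map_pow]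

lemma apply_aeval_polyCD (η : MulChar F Qbar) (m : ℤ) {n : ℕ} {a c : ℕ} {b : Fin n → ℕ}
    (ha : 0 < a) (hc : 0 < c) (hb : ∀ i, 0 < b i) (l : Fin n → k) (x : Fin 1 → F) :
    (η ^ m) (MvPolynomial.aeval x (polyCD a c b l)) =
      (∏ i, (η ^ (m * b i)) (1 - algebraMap k F (l i) * x 0)) * (η ^ (m * a)) (x 0) *
        (η ^ (m * c)) (1 - x 0) := by
  simp only [polyCD, map_mul, map_prod, map_pow (MvPolynomial.aeval x), map_sub, map_one,
    MvPolynomial.aeval_X, MvPolynomial.aeval_C, mulChar_pow_eq_zpow η ha,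
    mulChar_pow_eq_zpow η hc, mulChar_pow_eq_zpow η (hb _)]

lemma apply_aeval_polySD (η : MulChar F Qbar) (m : ℤ) {n : ℕ} {a c : ℕ} {b : Fin n → ℕ}
    (ha : 0 < a) (hc : 0 < c) (hb : ∀ i, 0 < b i) (l : Fin n → k) (x : Fin n → F) :
    (η ^ m) (MvPolynomial.aeval x (polySD a c b l)) =
      (η ^ (m * a)) (1 - ∑ i, algebraMap k F (l i) * x i) * (∏ i, (η ^ (m * b i)) (x i)) *
        (η ^ (m * c)) (1 - ∑ i, x i) := by
  simp only [polySD, map_mul, map_prod, map_sum, map_pow (MvPolynomial.aeval x), map_sub, map_one,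
    MvPolynomial.aeval_X, MvPolynomial.aeval_C, mulChar_pow_eq_zpow η ha,
    mulChar_pow_eq_zpow η hc, mulChar_pow_eq_zpow η (hb _)]

/-- Hasse–Davenport starts from a nontrivial additive character of `k` itself; one is obtained from
the extension of degree `1`. -/
lemma exists_addChar_ne_one {kbar : Type*} [Field kbar] [Algebra k kbar]
    {K : IntermediateField k kbar} (hK : Module.finrank k K = 1) {ψ : AddChar K Qbar}
    (hψ : ψ ≠ 1) : ∃ ψ₀ : AddChar k Qbar, ψ₀ ≠ 1 := by
  obtain ⟨t, ht⟩ := AddChar.ne_one_iff.1 hψ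
  have hmem : (t : kbar) ∈ (⊥ : IntermediateField k kbar) :=
    IntermediateField.finrank_eq_one_iff.1 hK ▸ t.2
  rw [IntermediateField.mem_bot] at hmem
  obtain ⟨s, hs⟩ := hmem
  refine ⟨ψ.compAddMonoidHom (algebraMap k K).toAddMonoidHom, AddChar.ne_one_iff.2 ⟨s, ?_⟩⟩
  have : algebraMap k K s = t := Subtype.ext hs
  change ψ (algebraMap k K s) ≠ 1
  rwa [this]

variable [Fintype k] [Fintype F]

lemma jacobiJ_pair_normLift {ψ : AddChar k Qbar} (hψ : ψ ≠ 1) (α : MulChar k Qbar)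
    {θ : MulChar k Qbar} (hθ : θ ≠ 1) :
    jacobiJ ![α, θ] ^ Module.finrank k F = jacobiJ ![normLift F α, normLift F θ] := by
  rw [← jacobiJ_normLift (L := F) hψ (η := ![α, θ]) (i := 1) (by simpa using hθ)]
  congr 1
  funext i
  fin_cases i <;> rfl

lemma jacobiJ_snoc_normLift {ψ : AddChar k Qbar} (hψ : ψ ≠ 1) {n : ℕ} (β : Fin n → MulChar k Qbar)
    {θ : MulChar k Qbar} (hθ : θ ≠ 1) :
    jacobiJ (Fin.snoc (α := fun _ => MulChar k Qbar) β θ) ^ Module.finrank k F =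
      jacobiJ (Fin.snoc (α := fun _ => MulChar F Qbar) (fun i => normLift F (β i))
        (normLift F θ)) := by
  rw [← jacobiJ_normLift (L := F) hψ (i := Fin.last n) (by simpa using hθ)]
  congr 1
  funext i
  refine Fin.lastCases ?_ (fun i => ?_) i
  · simp only [Fin.snoc_last]
  · simp only [Fin.snoc_castSucc]

end Evaluation

section TwistedCounts

variable {k : Type*} [Field k] [Fintype k] {kbar : Type*} [Field kbar] [Algebra k kbar]
  [IsAlgClosed kbar] {K : IntermediateField k kbar} [Fintype K] {r : ℕ+}
  {n : ℕ} {d a c : ℕ} [NeZero d] {b : Fin n → ℕ} {l : Fin n → k} {φ : MulChar k Qbar} {m : ℤ}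

/-- Coprimality to `c` keeps the last character of the Jacobi sum nontrivial, and coprimality to the
`b i` permits the binomial expansions. The character with exponent `a` may be trivial. -/
lemma twistedCount_polyCD (hr : Module.finrank k K = r) {ψ₀ : AddChar k Qbar} (hψ₀ : ψ₀ ≠ 1)
    {ψ : AddChar K Qbar} (hψ : ψ ≠ 1) (ha : 0 < a) (hc : 0 < c) (hb : ∀ i, 0 < b i)
    (hl : ∀ i, l i ≠ 0) (hd : d ∣ Fintype.card k - 1)
    (hφ : ∀ η : MulChar k Qbar, η ∈ Subgroup.zpowers φ) (hm : ¬(d : ℤ) ∣ m)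
    (hdc : d.Coprime c) (hdb : ∀ i, d.Coprime (b i)) :
    twistedCount (CoverPoints.frob : CoverPoints kbar d (polyCD a c b l) → _)
        (restrictRoots φ d ^ m) r =
      -(jacobiJ ![charD φ d ^ (m * a), charD φ d ^ (m * c)] ^ (r : ℕ) *
        lauricellaFD ψ (normLift K (charD φ d) ^ (m * a))
          (fun i => (normLift K (charD φ d))⁻¹ ^ (m * b i))
          (normLift K (charD φ d) ^ (m * (c + a))) (fun i => algebraMap k K (l i))) := by
  have hne {j : ℕ} (hj : d.Coprime j) : charD φ d ^ (m * j) ≠ 1 := fun h =>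
    hm ((Nat.isCoprime_iff_coprime.2 hj).dvd_of_dvd_mul_right
      ((charD_zpow_eq_one_iff hφ hd _).1 h))
  have hneK {j : ℕ} (hj : d.Coprime j) : normLift K (charD φ d) ^ (m * j) ≠ 1 := by
    rw [← normLift_zpow, Ne, normLift_eq_one_iff]
    exact hne hj
  have hγ : normLift K (charD φ d) ^ (m * (c + a) : ℤ) =
      normLift K (charD φ d) ^ (m * a) * normLift K (charD φ d) ^ (m * c) := by
    rw [← zpow_add]
    ring_nf
  rw [twistedCount_zpow K hd _ hφ hm r hr, ← hr, jacobiJ_pair_normLift hψ₀ _ (hne hdc),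
    normLift_zpow, normLift_zpow, hγ, jacobiJ_pair_mul_lauricellaFD hψ _ (hneK hdc), neg_neg,
    ← (Equiv.funUnique (Fin 1) K).symm.sum_comp]
  · refine Finset.sum_congr rfl fun x _ => ?_
    rw [apply_aeval_polyCD _ _ ha hc hb]
    simp
  · intro i
    rw [inv_zpow]
    exact inv_ne_one.2 (hneK (hdb i))
  · intro i
    simpa using hl i

/-- Here the factor with exponent `a` is expanded, so `a` must be prime to `d` and the `b i` are
unrestricted. The sign `(-1) ^ n` undoes the one in the definition of the Jacobi sum. -/
lemma twistedCount_polySD (hr : Module.finrank k K = r) {ψ₀ : AddChar k Qbar} (hψ₀ : ψ₀ ≠ 1)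
    {ψ : AddChar K Qbar} (hψ : ψ ≠ 1) (ha : 0 < a) (hc : 0 < c) (hb : ∀ i, 0 < b i)
    (hl : ∀ i, l i ≠ 0) (hd : d ∣ Fintype.card k - 1)
    (hφ : ∀ η : MulChar k Qbar, η ∈ Subgroup.zpowers φ) (hm : ¬(d : ℤ) ∣ m)
    (hda : d.Coprime a) (hdc : d.Coprime c) :
    twistedCount (CoverPoints.frob : CoverPoints kbar d (polySD a c b l) → _)
        (restrictRoots φ d ^ m) r =
      (-1) ^ n * (jacobiJ (Fin.snoc (α := fun _ => MulChar k Qbar)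
          (fun i => charD φ d ^ (m * b i)) (charD φ d ^ (m * c))) ^ (r : ℕ) *
        lauricellaFD ψ ((normLift K (charD φ d))⁻¹ ^ (m * a))
          (fun i => normLift K (charD φ d) ^ (m * b i))
          (normLift K (charD φ d) ^ (m * ((∑ i, (b i : ℤ)) + c)))
          (fun i => algebraMap k K (l i))) := by
  have hne {j : ℕ} (hj : d.Coprime j) : charD φ d ^ (m * j) ≠ 1 := fun h =>
    hm ((Nat.isCoprime_iff_coprime.2 hj).dvd_of_dvd_mul_right
      ((charD_zpow_eq_one_iff hφ hd _).1 h))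
  have hneK {j : ℕ} (hj : d.Coprime j) : normLift K (charD φ d) ^ (m * j) ≠ 1 := by
    rw [← normLift_zpow, Ne, normLift_eq_one_iff]
    exact hne hj
  have hprod (s : Finset (Fin n)) : ∏ i ∈ s, normLift K (charD φ d) ^ (m * b i) =
      normLift K (charD φ d) ^ (m * ∑ i ∈ s, (b i : ℤ)) := by
    classical
    induction s using Finset.induction_on with
    | empty => simp
    | insert i s hi ih =>
      rw [Finset.prod_insert hi, Finset.sum_insert hi, ih, mul_add, zpow_add]
  have hγ : normLift K (charD φ d) ^ (m * ((∑ i, (b i : ℤ)) + c)) =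
      (∏ i, normLift K (charD φ d) ^ (m * b i)) * normLift K (charD φ d) ^ (m * c) := by
    rw [hprod, ← zpow_add, mul_add]
  rw [twistedCount_zpow K hd _ hφ hm r hr, ← hr, jacobiJ_snoc_normLift hψ₀ _ (hne hdc)]
  simp only [normLift_zpow]
  rw [hγ, inv_zpow, jacobiJ_mul_lauricellaFD hψ (inv_ne_one.2 (hneK hda)) (hneK hdc),
    ← mul_assoc, ← mul_pow, neg_one_mul, neg_neg, one_pow, one_mul]
  · refine Finset.sum_congr rfl fun x _ => ?_
    rw [apply_aeval_polySD _ _ ha hc hb, inv_inv]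
  · intro i
    simpa using hl i

end TwistedCounts

end

theorem mainTheorem12
    {k : Type*} [Field k] [Fintype k]
    {kbar : Type*} [Field kbar] [Algebra k kbar] [IsAlgClosure k kbar]
    -- `K r` is the extension of `k` of degree `r` in `kbar`, with a nontrivial additive character
    (K : ℕ+ → IntermediateField k kbar) [∀ r, Fintype (K r)]
    (hK : ∀ r, Module.finrank k (K r) = r)
    (ψ : ∀ r, AddChar (K r) Qbar) (hψ : ∀ r, ψ r ≠ 1)
    {n : ℕ} (d a c : ℕ) [NeZero d] (b : Fin n → ℕ)
    (ha : 0 < a) (hc : 0 < c) (hb : ∀ i, 0 < b i)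
    (l : Fin n → k) (hl : ∀ i, l i ≠ 0)
    (hd : d ∣ Fintype.card k - 1)
    (φ : MulChar k Qbar) (hφ : ∀ η : MulChar k Qbar, η ∈ Subgroup.zpowers φ)
    -- the exponent `m` matters only modulo `d`
    (m : ℤ) :
    ((d.Coprime c ∧ ∀ i, d.Coprime (b i)) →
      ((d : ℤ) ∣ m →
        artinLCD kbar d a c b l (restrictRoots φ d ^ m) =
          (1 - PowerSeries.C (Fintype.card k : Qbar) * PowerSeries.X)⁻¹) ∧
      (¬ (d : ℤ) ∣ m →
        artinLCD kbar d a c b l (restrictRoots φ d ^ m) =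
          (expSeries fun r =>
            jacobiJ ![charD φ d ^ (m * a), charD φ d ^ (m * c)] ^ (r : ℕ) *
              lauricellaFD (ψ r)
                (normLift (K r) (charD φ d) ^ (m * a))
                (fun i => (normLift (K r) (charD φ d))⁻¹ ^ (m * b i))
                (normLift (K r) (charD φ d) ^ (m * (c + a)))
                (fun i => algebraMap k (K r) (l i)))⁻¹)) ∧
    ((d.Coprime a ∧ d.Coprime c) →
      ((d : ℤ) ∣ m →
        artinLSD kbar d a c b l (restrictRoots φ d ^ m) =
          (1 - PowerSeries.C ((Fintype.card k : Qbar) ^ n) * PowerSeries.X)⁻¹) ∧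
      (¬ (d : ℤ) ∣ m →
        artinLSD kbar d a c b l (restrictRoots φ d ^ m) =
          signPow
            (expSeries fun r =>
              jacobiJ (Fin.snoc (α := fun _ => MulChar k Qbar)
                  (fun i => charD φ d ^ (m * b i)) (charD φ d ^ (m * c))) ^ (r : ℕ) *
                lauricellaFD (ψ r)
                  ((normLift (K r) (charD φ d))⁻¹ ^ (m * a))
                  (fun i => normLift (K r) (charD φ d) ^ (m * b i))
                  (normLift (K r) (charD φ d) ^ (m * ((∑ i, (b i : ℤ)) + c)))
                  (fun i => algebraMap k (K r) (l i)))
            n)) := by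
  have hcl : IsAlgClosed kbar := IsAlgClosure.isAlgClosed k
  obtain ⟨ψ₀, hψ₀⟩ := exists_addChar_ne_one (by simpa using hK 1) (hψ 1)
  refine ⟨fun ⟨hdc, hdb⟩ => ⟨fun hm => ?_, fun hm => ?_⟩,
    fun ⟨hda, hdc⟩ => ⟨fun hm => ?_, fun hm => ?_⟩⟩
  · rw [artinLCD, artinL, restrictRoots_zpow_eq_one φ hm, ← expSeries_pow]
    congr 1
    funext r
    rw [twistedCount_one (K r) hd _ r (hK r), Fintype.card_fin, pow_one]
  · rw [artinLCD, artinL, ← expSeries_neg]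
    congr 1
    funext r
    exact twistedCount_polyCD (hK r) hψ₀ (hψ r) ha hc hb hl hd hφ hm hdc hdb
  · rw [artinLSD, artinL, restrictRoots_zpow_eq_one φ hm, ← expSeries_pow]
    congr 1
    funext r
    rw [twistedCount_one (K r) hd _ r (hK r), Fintype.card_fin]
  · have hN := fun r =>
      twistedCount_polySD (hK r) hψ₀ (hψ r) ha hc hb hl hd hφ hm hda hdc
    rw [artinLSD, artinL, signPow]
    split_ifs with hn
    · congr 1
      funext r
      rw [hN, hn.neg_one_pow, one_mul]
    · rw [← expSeries_neg]
      congr 1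
      funext r
      rw [hN, (Nat.not_even_iff_odd.1 hn).neg_one_pow, neg_one_mul]
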